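/- **Definitions.** For a matrix $M\in\mathbb{R}^{d\times d}$ write $M^*$ for its transpose; $A\in\mathrm{GL}(d,\mathbb{R})$ is *expansive* if every complex eigenvalue $\lambda$ of $A$ satisfies $|\lambda|>1$. The Fourier transform is $\widehat f(\xi)=\int_{\mathbb{R}^d} f(x)e^{-2\pi i x\cdot\xi}\,dx$. A pair $(\varphi,\Phi)$ of Schwartz functions on $\mathbb{R}^d$ is an *$A$-analyzing pair* if the closed support of $\widehat\varphi$ is contained in $(-\tfrac12,\tfrac12)^d\setminus\{0\}$, the closed support of $\widehat\Phi$ is contained in $(-\tfrac12,\tfrac12)^d$, and $\sup_{i\ge 1}\max\{|\widehat\varphi((A^*)^{-i}\xi)|,|\widehat\Phi(\xi)|\}>0$ for all $\xi\in\mathbb{R}^d$. Put $\varphi_0^A=\Phi$ and $\varphi_i^A=|\det A|^i\varphi(A^i\,\cdot)$ for $i\ge1$. For $\alpha\in\mathbb{R}$, $p\in(0,\infty)$, $q\in(0,\infty]$, the inhomogeneous anisotropic Triebel–Lizorkin space $\mathbf{F}^{\alpha}_{p,q}(A)=\mathbf{F}^{\alpha}_{p,q}(A;\varphi,\Phi)$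 is the set of all tempered distributions $f$ on $\mathbb{R}^d$ with $$\Big\|\Big(\sum_{i=0}^\infty\big(|\det A|^{\alpha i}\,|f*\varphi_i^A|\big)^q\Big)^{1/q}\Big\|_{L^p(\mathbb{R}^d)}<\infty,$$ with the supremum over $i$ in place of the sum if $q=\infty$. For an expansive $M$, a *homogeneous quasi-norm associated to $M$* is a Lebesgue measurable function $\rho:\mathbb{R}^d\to[0,\infty)$ such that $\rho(x)=0$ if and only if $x=0$, $\rho(Mx)=|\det M|\,\rho(x)$ for all $x$, and $\rho(x+y)\le C(\rho(x)+\rho(y))$ for all $x,y$ and some constant $C>0$. Two expansive matrices $M,N$ are *coarsely equivalent* if for all homogeneous quasi-norms $\rho_M,\rho_N$ associated to $M$ and $N$, respectively, there are constants $C>0$ and $R\ge0$ with $\frac1C\rho_M(x)-R\le\rho_N(x)\le C\rho_M(x)+R$ for all $x\in\mathbb{R}^d$. **Theorem.** Let $A,B\in\mathrm{GL}(d,\mathbb{R})$ be expansive, let $(\varphi,\Phi)$ be an $A$-analyzing pair and $(\psi,\Psi)$ a $B$-analyzing pair. Suppose that $\mathbf{F}^{\alpha}_{p,q}(A;\varphi,\Phi)=\mathbf{F}^{\alpha}_{p,q}(B;\psi,\Psi)$,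 as sets of tempered distributions, for some $\alpha\in\mathbb{R}\setminus\{0\}$, $p\in(0,\infty)$ and $q\in(0,\infty]$. Then $A^*$ and $B^*$ are coarsely equivalent. -/

import Mathlib

open MeasureTheory
open scoped ENNReal Matrix MatrixGroups FourierTransform SchwartzMap

noncomputable section

namespace AnisotropicTL

/-- `ℝ^d` with the Euclidean norm. -/
abbrev Space (d : ℕ) : Type := EuclideanSpace ℝ (Fin d)

/-- The action `x ↦ M x` of a real `d × d` matrix on `ℝ^d`. -/
def act {d : ℕ} (M : Matrix (Fin d) (Fin d) ℝ) : Space d →L[ℝ] Space d :=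
  Matrix.toEuclideanCLM (n := Fin d) (𝕜 := ℝ) M

theorem act_apply {d : ℕ} (M : Matrix (Fin d) (Fin d) ℝ) (x : Space d) (k : Fin d) :
    act M x k = ∑ l, M k l * x l := by
  simp only [act, Matrix.ofLp_toEuclideanCLM]
  rfl

/-- The action of an invertible matrix, as a linear homeomorphism of `ℝ^d`. -/
def actEquiv {d : ℕ} (A : GL (Fin d) ℝ) : Space d ≃L[ℝ] Space d :=
  ContinuousLinearEquiv.equivOfInverse
    (act (A : Matrix (Fin d) (Fin d) ℝ)) (act ((A⁻¹ : GL (Fin d) ℝ) : Matrix (Fin d) (Fin d) ℝ))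
    (fun x => by
      have h : act ((A⁻¹ : GL (Fin d) ℝ) : Matrix (Fin d) (Fin d) ℝ) *
          act (A : Matrix (Fin d) (Fin d) ℝ) = 1 := by
        rw [act, act, ← map_mul, Units.inv_mul, map_one]
      exact DFunLike.congr_fun h x)
    (fun x => by
      have h : act (A : Matrix (Fin d) (Fin d) ℝ) *
          act ((A⁻¹ : GL (Fin d) ℝ) : Matrix (Fin d) (Fin d) ℝ) = 1 := by
        rw [act, act, ← map_mul, Units.mul_inv, map_one]
      exact DFunLike.congr_fun h x)

theorem actEquiv_apply {d : ℕ} (A : GL (Fin d) ℝ) (x : Space d) :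
    actEquiv A x = act (A : Matrix (Fin d) (Fin d) ℝ) x := rfl

/-- A real square matrix is expansive if all of its complex eigenvalues have modulus `> 1`. -/
def IsExpansive {d : ℕ} (M : Matrix (Fin d) (Fin d) ℝ) : Prop :=
  ∀ z ∈ spectrum ℂ (M.map (algebraMap ℝ ℂ)), 1 < ‖z‖

/-- `ρ : ℝ^d → [0, ∞)` is a (Lebesgue) measurable homogeneous quasi-norm associated to `M`. -/
structure IsHomogeneousQuasiNorm {d : ℕ} (M : Matrix (Fin d) (Fin d) ℝ) (ρ : Space d → ℝ) :
    Prop where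
  measurable : NullMeasurable ρ volume
  nonneg : ∀ x, 0 ≤ ρ x
  eq_zero_iff : ∀ x, ρ x = 0 ↔ x = 0
  dilation : ∀ x, ρ (act M x) = |M.det| * ρ x
  triangle : ∃ C : ℝ, 0 < C ∧ ∀ x y, ρ (x + y) ≤ C * (ρ x + ρ y)

/-- Coarse equivalence of two functions on `ℝ^d`. -/
def CoarselyEquivalentFun {d : ℕ} (ρ ρ' : Space d → ℝ) : Prop :=
  ∃ C R : ℝ, 0 < C ∧ 0 ≤ R ∧ ∀ x, (1 / C) * ρ x - R ≤ ρ' x ∧ ρ' x ≤ C * ρ x + R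

/-- Two (expansive) matrices are coarsely equivalent if their associated homogeneous quasi-norms
are coarsely equivalent.  The quasi-norms associated to one expansive matrix exist and are mutually
equivalent; here every choice of the two quasi-norms is required to be coarsely equivalent. -/
def CoarselyEquivalent {d : ℕ} (M N : Matrix (Fin d) (Fin d) ℝ) : Prop :=
  ∀ ρ ρ' : Space d → ℝ, IsHomogeneousQuasiNorm M ρ → IsHomogeneousQuasiNorm N ρ' →
    CoarselyEquivalentFun ρ ρ'

/-- The open cube `(-1/2, 1/2)^d`. -/
def cube (d : ℕ) : Set (Space d) := {ξ | ∀ k, ξ k ∈ Set.Ioo (-(1 / 2) : ℝ) (1 / 2)}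

/-- `(φ, Φ)` is an `A`-analyzing pair. Mathlib's Fourier transform `𝓕` has the kernel
`exp (-2πi x·ξ)`, and `tsupport` is the closed support. -/
structure IsAnalyzingPair {d : ℕ} (A : GL (Fin d) ℝ) (φ Φ : 𝓢(Space d, ℂ)) : Prop where
  tsupport_fourier_subset : tsupport (𝓕 φ : 𝓢(Space d, ℂ)) ⊆ cube d \ {0}
  tsupport_fourier_subset' : tsupport (𝓕 Φ : 𝓢(Space d, ℂ)) ⊆ cube d
  positive : ∀ ξ : Space d, ∃ i : ℕ, 1 ≤ i ∧
    0 < max ‖(𝓕 φ : 𝓢(Space d, ℂ)) (act ((A : Matrix (Fin d) (Fin d) ℝ)ᵀ⁻¹ ^ i) ξ)‖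
      ‖(𝓕 Φ : 𝓢(Space d, ℂ)) ξ‖

/-- The `L¹`-normalized dilate `|det A|^i φ(A^i ·)`. -/
def dilate {d : ℕ} (A : GL (Fin d) ℝ) (φ : 𝓢(Space d, ℂ)) (i : ℕ) : 𝓢(Space d, ℂ) :=
  ((|(A : Matrix (Fin d) (Fin d) ℝ).det| ^ i : ℝ) : ℂ) •
    SchwartzMap.compCLMOfContinuousLinearEquiv ℂ (actEquiv (A ^ i)) φ

theorem dilate_apply {d : ℕ} (A : GL (Fin d) ℝ) (φ : 𝓢(Space d, ℂ)) (i : ℕ) (x : Space d) :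
    dilate A φ i x = ((|(A : Matrix (Fin d) (Fin d) ℝ).det| ^ i : ℝ) : ℂ) *
      φ (act ((A : Matrix (Fin d) (Fin d) ℝ) ^ i) x) := rfl

/-- The sequence `φ₀ᴬ = Φ` and `φᵢᴬ = |det A|^i φ(A^i ·)` for `i ≥ 1`. -/
def window {d : ℕ} (A : GL (Fin d) ℝ) (φ Φ : 𝓢(Space d, ℂ)) (i : ℕ) : 𝓢(Space d, ℂ) :=
  if i = 0 then Φ else dilate A φ i

/-- The Schwartz function `y ↦ φ (x - y)`. -/
def reflectAt {d : ℕ} (φ : 𝓢(Space d, ℂ)) (x : Space d) : 𝓢(Space d, ℂ) :=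
  SchwartzMap.compSubConstCLM ℂ x
    (SchwartzMap.compCLMOfContinuousLinearEquiv ℂ (ContinuousLinearEquiv.neg ℝ) φ)

theorem reflectAt_apply {d : ℕ} (φ : 𝓢(Space d, ℂ)) (x y : Space d) :
    reflectAt φ x y = φ (x - y) := by
  change φ (-(y - x)) = φ (x - y)
  rw [neg_sub]

/-- The convolution `(f * φ)(x) = f (φ (x - ·))` of a tempered distribution with a Schwartz
function (the pairing is bilinear). -/
def conv {d : ℕ} (f : 𝓢'(Space d, ℂ)) (φ : 𝓢(Space d, ℂ)) (x : Space d) : ℂ :=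
  f (reflectAt φ x)

/-- The `ℓ^q(ℕ₀)` (quasi-)norm of a sequence of nonnegative numbers, with the supremum if
`q = ∞`. -/
def seqNorm (q : ℝ≥0∞) (c : ℕ → ℝ≥0∞) : ℝ≥0∞ :=
  if q = ∞ then ⨆ i, c i else (∑' i, c i ^ q.toReal) ^ (1 / q.toReal)

/-- The inhomogeneous Triebel–Lizorkin (quasi-)norm
`‖ ( ∑_{i ≥ 0} (|det A|^{α i} |f * φᵢᴬ|)^q )^{1/q} ‖_{L^p}`, with values in `[0, ∞]`. -/
def tlNorm {d : ℕ} (A : GL (Fin d) ℝ) (φ Φ : 𝓢(Space d, ℂ)) (α : ℝ) (p q : ℝ≥0∞)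
    (f : 𝓢'(Space d, ℂ)) : ℝ≥0∞ :=
  eLpNorm (fun x : Space d => seqNorm q fun i : ℕ =>
    ENNReal.ofReal (|(A : Matrix (Fin d) (Fin d) ℝ).det| ^ (α * i)) *
      ‖conv f (window A φ Φ i) x‖ₑ) p volume

/-- The inhomogeneous anisotropic Triebel–Lizorkin space `F^α_{p,q}(A) = F^α_{p,q}(A; φ, Φ)`. -/
def TLSpace {d : ℕ} (A : GL (Fin d) ℝ) (φ Φ : 𝓢(Space d, ℂ)) (α : ℝ) (p q : ℝ≥0∞) :
    Set (𝓢'(Space d, ℂ)) :=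
  {f | tlNorm A φ Φ α p q f < ∞}

end AnisotropicTL

end

noncomputable section

namespace AnisotropicTL

open Filter Topology Bornology

variable {d : ℕ}

/-! Write `N = (A*)⁻¹`. Whenever `N ^ i ξ` lies in a fixed annulus, homogeneity makes a quasi-norm
of `A*` at `ξ` comparable to `|det A| ^ i`. Coarse equivalence thus reduces to comparing `|det A| ^
i` with `|det B| ^ j` for indices `i`, `j` in the two shells of every large `ξ`
(`coarselyEquivalent_of_shell`).

The spaces detect this comparison. Let `g` have Fourier transform supported in a tiny ball. Its
modulation by a large frequency `ξ` is seen only by windows with index in the shell of `ξ`, so for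
the spaces of `A` and `B` its size is about `|det A| ^ (α i)` and `|det B| ^ (α j)`. If these are
not comparable in the direction given by `F(B) ⊆ F(A)`, choose frequencies `ξ n` with pairwise
disjoint shells and ratio at least `4 ^ n` (`exists_lacunary_seq`). The sum of the waves at `ξ n`
with coefficients `2⁻¹ ^ n * |det B| ^ (-α (j n))` then lies in `F(B)` (`mem_TLSpace_of_wave_sum`),
while its `A`-pieces are at least of order `2 ^ n` on a fixed ball, so it is not in `F(A)`
(`notMem_TLSpace_of_wave_sum`).

Both inclusions give both bounds on `|det A| ^ (α i)` and `|det B| ^ (α j)`; since `α ≠ 0`, the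
exponent `α` can be removed. -/

/-! ### Exponential decay of the powers of an inverse expansive matrix -/

/-- Gelfand's formula, with `θ` strictly between the spectral radius and `1`; the finitely many
early powers are absorbed into `C`. -/
theorem exists_norm_pow_le_of_spectrum {E : Type*} [NormedRing E] [NormedAlgebra ℂ E]
    [CompleteSpace E] [Nontrivial E] (a : E) (h : ∀ z ∈ spectrum ℂ a, ‖z‖ < 1) :
    ∃ C θ : ℝ, 1 ≤ C ∧ 0 < θ ∧ θ < 1 ∧ ∀ i : ℕ, ‖a ^ i‖ ≤ C * θ ^ i := by
  have h1 : spectralRadius ℂ a < ((1 : NNReal) : ℝ≥0∞) :=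
    spectrum.spectralRadius_lt_of_forall_lt a (fun z hz => by exact_mod_cast h z hz)
  obtain ⟨r, hr1, hr2⟩ := ENNReal.lt_iff_exists_nnreal_btwn.1 h1
  have hr0 : 0 < r := by
    have : (0 : ℝ≥0∞) < r := lt_of_le_of_lt zero_le hr1
    exact_mod_cast this
  have hr2' : r < 1 := by exact_mod_cast hr2
  have h2 := (spectrum.pow_nnnorm_pow_one_div_tendsto_nhds_spectralRadius a).eventually_lt_const hr1
  have h3 : (fun n : ℕ => a ^ n) =O[atTop] (fun n : ℕ => (r : ℝ) ^ n) := by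
    refine Asymptotics.IsBigO.of_bound 1 ?_
    filter_upwards [h2, eventually_gt_atTop 0] with n hn hn0
    have hn' : (n : ℝ) ≠ 0 := by positivity
    have h4 : ((‖a ^ n‖₊ : ℝ≥0∞) ^ (1 / n : ℝ)) ^ (n : ℝ) ≤ (r : ℝ≥0∞) ^ (n : ℝ) :=
      ENNReal.rpow_le_rpow hn.le (by positivity)
    rw [← ENNReal.rpow_mul, one_div_mul_cancel hn', ENNReal.rpow_one, ENNReal.rpow_natCast] at h4
    have h5 : ‖a ^ n‖₊ ≤ r ^ n := by exact_mod_cast h4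
    have h6 : ‖a ^ n‖ ≤ (r : ℝ) ^ n := by exact_mod_cast h5
    simpa using h6
  obtain ⟨C, hC, hb⟩ := Asymptotics.bound_of_isBigO_nat_atTop h3
  refine ⟨max C 1, r, le_max_right _ _, by exact_mod_cast hr0, by exact_mod_cast hr2', fun i => ?_⟩
  have h7 : ‖a ^ i‖ ≤ C * ‖(r : ℝ) ^ i‖ := hb (by
    have : (0 : ℝ) < r := by exact_mod_cast hr0
    positivity)
  rw [Real.norm_of_nonneg (by positivity)] at h7
  exact h7.trans (by gcongr; exact le_max_left _ _)


/-- Transfers the decay, which Gelfand's formula gives over `ℂ`, to the real matrix through the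
isometric inclusion of `ℝ^d` in `ℂ^d`. -/
theorem norm_act_le_complex (M : Matrix (Fin d) (Fin d) ℝ) :
    ‖act M‖ ≤ ‖Matrix.toEuclideanCLM (n := Fin d) (𝕜 := ℂ) (M.map (algebraMap ℝ ℂ))‖ := by
  refine ContinuousLinearMap.opNorm_le_bound _ (norm_nonneg _) fun x => ?_
  let c : Space d → EuclideanSpace ℂ (Fin d) := fun y => WithLp.toLp 2 fun k => (y k : ℂ)
  have hc : ∀ y, ‖c y‖ = ‖y‖ := fun y => by
    simp [EuclideanSpace.norm_eq, c]
  have hM : Matrix.toEuclideanCLM (n := Fin d) (𝕜 := ℂ) (M.map (algebraMap ℝ ℂ)) (c x) =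
      c (act M x) := by
    ext k
    simp only [c, Matrix.ofLp_toEuclideanCLM, act_apply, Matrix.mulVec, dotProduct]
    push_cast
    rfl
  rw [← hc (act M x), ← hM, ← hc x]
  exact ContinuousLinearMap.le_opNorm _ _

theorem act_one : act (1 : Matrix (Fin d) (Fin d) ℝ) = 1 := map_one _

theorem act_mul (M N : Matrix (Fin d) (Fin d) ℝ) : act (M * N) = act M * act N := map_mul _ _ _

theorem act_mul_apply (M N : Matrix (Fin d) (Fin d) ℝ) (x : Space d) :
    act (M * N) x = act M (act N x) := by
  rw [act_mul]; rfl

theorem inner_act_transpose (M : Matrix (Fin d) (Fin d) ℝ) (x y : Space d) :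
    inner ℝ (act Mᵀ x) y = inner ℝ x (act M y) := by
  simp only [PiLp.inner_apply, act_apply, RCLike.inner_apply, conj_trivial, Finset.mul_sum,
    Finset.sum_mul, Matrix.transpose_apply]
  rw [Finset.sum_comm]
  refine Finset.sum_congr rfl fun _ _ => Finset.sum_congr rfl fun _ _ => by ring

/-- The powers of `N` decay exponentially. -/
def PowDecay (N : Matrix (Fin d) (Fin d) ℝ) : Prop :=
  ∃ C θ : ℝ, 1 ≤ C ∧ 0 < θ ∧ θ < 1 ∧ ∀ i : ℕ, ‖act (N ^ i)‖ ≤ C * θ ^ i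

theorem IsExpansive.powDecay_inv [NeZero d] {M : Matrix (Fin d) (Fin d) ℝ} (hM : IsExpansive M)
    (hu : IsUnit M) : PowDecay M⁻¹ := by
  let T := Matrix.toEuclideanCLM (n := Fin d) (𝕜 := ℂ)
  have : Nontrivial (EuclideanSpace ℂ (Fin d)) := inferInstance
  obtain ⟨u, hu⟩ := hu
  let f : Matrix (Fin d) (Fin d) ℝ →+* Matrix (Fin d) (Fin d) ℂ := (algebraMap ℝ ℂ).mapMatrix
  let v : (Matrix (Fin d) (Fin d) ℂ)ˣ := Units.map f.toMonoidHom u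
  have hspec : ∀ z ∈ spectrum ℂ (T (f M⁻¹)), ‖z‖ < 1 := by
    intro z hz
    rw [AlgEquiv.spectrum_eq T] at hz
    have hv : f M⁻¹ = ((v⁻¹ : (Matrix (Fin d) (Fin d) ℂ)ˣ) : Matrix (Fin d) (Fin d) ℂ) := by
      rw [← hu, ← Matrix.coe_units_inv]; rfl
    rw [hv, ← spectrum.map_inv, Set.mem_inv] at hz
    have hz' := hM _ (by rw [← hu]; exact hz)
    rw [norm_inv] at hz'
    by_contra hcon
    exact absurd (inv_le_one_of_one_le₀ (not_lt.1 hcon)) (not_le.2 hz')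
  obtain ⟨C, θ, hC, h0, h1, hb⟩ := exists_norm_pow_le_of_spectrum _ hspec
  refine ⟨C, θ, hC, h0, h1, fun i => (norm_act_le_complex _).trans ?_⟩
  have : T ((M⁻¹ ^ i).map (algebraMap ℝ ℂ)) = T (f M⁻¹) ^ i := by
    rw [← map_pow, ← map_pow]; rfl
  exact this ▸ hb i

theorem IsExpansive.transpose {M : Matrix (Fin d) (Fin d) ℝ} (hM : IsExpansive M) :
    IsExpansive Mᵀ := by
  intro z hz
  refine hM z ?_
  rw [spectrum.mem_iff] at hz ⊢
  contrapose! hz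
  rw [Matrix.isUnit_iff_isUnit_det] at hz ⊢
  rw [← Matrix.det_transpose] at hz
  convert! hz using 2
  ext i j
  simp [Matrix.algebraMap_matrix_apply, eq_comm]

/-! ### Shells of a frequency -/

/-- The exponents `i` for which `N ^ i ξ` lies in the annulus of radii `r` and `R`. -/
def shell (N : Matrix (Fin d) (Fin d) ℝ) (r R : ℝ) (ξ : Space d) : Set ℕ :=
  {i | r ≤ ‖act (N ^ i) ξ‖ ∧ ‖act (N ^ i) ξ‖ ≤ R}

theorem act_pow_add (N : Matrix (Fin d) (Fin d) ℝ) (i j : ℕ) (ξ : Space d) :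
    act (N ^ (i + j)) ξ = act (N ^ i) (act (N ^ j) ξ) := by
  rw [pow_add, act_mul_apply]

variable {N : Matrix (Fin d) (Fin d) ℝ}

theorem PowDecay.tendsto (hN : PowDecay N) : Tendsto (fun i : ℕ => ‖act (N ^ i)‖) atTop (𝓝 0) := by
  obtain ⟨C, θ, hC, h0, h1, hb⟩ := hN
  refine squeeze_zero (fun _ => norm_nonneg _) hb ?_
  simpa using (tendsto_pow_atTop_nhds_zero_of_lt_one h0.le h1).const_mul C

theorem PowDecay.exists_bound (hN : PowDecay N) : ∃ C : ℝ, 1 ≤ C ∧ ∀ i : ℕ, ‖act (N ^ i)‖ ≤ C := by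
  obtain ⟨C, θ, hC, h0, h1, hb⟩ := hN
  exact ⟨C, hC, fun i => (hb i).trans (mul_le_of_le_one_right (by linarith)
    (pow_le_one₀ h0.le h1.le))⟩

theorem PowDecay.tendsto_apply (hN : PowDecay N) (ξ : Space d) :
    Tendsto (fun i : ℕ => ‖act (N ^ i) ξ‖) atTop (𝓝 0) := by
  refine squeeze_zero (fun _ => norm_nonneg _) (fun i => ContinuousLinearMap.le_opNorm _ _) ?_
  simpa using hN.tendsto.mul_const ‖ξ‖

theorem shell_finite (hN : PowDecay N) {r : ℝ} (hr : 0 < r) (R : ℝ) (ξ : Space d) :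
    (shell N r R ξ).Finite := by
  have h := (hN.tendsto_apply ξ).eventually_lt_const hr
  rw [← Nat.cofinite_eq_atTop, eventually_cofinite] at h
  exact h.subset fun i hi => not_lt.2 hi.1

theorem eventually_lt_norm_act (hu : IsUnit N) (R : ℝ) :
    ∀ᶠ ξ in cobounded (Space d), R < ‖act N ξ‖ := by
  obtain ⟨u, rfl⟩ := hu
  have h : ∀ ξ, ‖ξ‖ ≤ ‖act (↑u⁻¹ : Matrix (Fin d) (Fin d) ℝ)‖ *
      ‖act (u : Matrix (Fin d) (Fin d) ℝ) ξ‖ := fun ξ => by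
    conv_lhs => rw [show ξ = act (↑u⁻¹ : Matrix (Fin d) (Fin d) ℝ)
      (act (u : Matrix (Fin d) (Fin d) ℝ) ξ) by
        rw [← act_mul_apply, Units.inv_mul, act_one]; rfl]
    exact ContinuousLinearMap.le_opNorm _ _
  filter_upwards [tendsto_norm_cobounded_atTop.eventually_gt_atTop
    (‖act (↑u⁻¹ : Matrix (Fin d) (Fin d) ℝ)‖ * R)] with ξ hξ
  exact lt_of_mul_lt_mul_left (hξ.trans_le (h ξ)) (norm_nonneg _)

theorem eventually_notMem_shell (hu : IsUnit N) (r R : ℝ) (i : ℕ) :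
    ∀ᶠ ξ in cobounded (Space d), i ∉ shell N r R ξ := by
  filter_upwards [eventually_lt_norm_act (hu.pow i) R] with ξ hξ hi
  exact absurd hi.2 (not_le.2 hξ)

/-- Each fixed index leaves the shell as `ξ → ∞`, and `P` has only finitely many exceptions. -/
theorem eventually_forall_shell (hu : IsUnit N) (r R : ℝ) {P : ℕ → Prop}
    (hP : ∀ᶠ i in atTop, P i) : ∀ᶠ ξ in cobounded (Space d), ∀ i ∈ shell N r R ξ, P i := by
  rw [← Nat.cofinite_eq_atTop, eventually_cofinite] at hP
  have := (hP.eventually_all (l := cobounded (Space d))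
    (p := fun i ξ => i ∉ shell N r R ξ)).2 fun i _ => eventually_notMem_shell hu r R i
  filter_upwards [this] with ξ hξ i hi
  by_contra hc
  exact hξ i hc hi

/-- Once `‖N ^ k‖ * R < r`, a further `k` steps carry the outer ball below the inner radius, so
shells have uniformly bounded length. -/
theorem exists_shell_diam (hN : PowDecay N) {r R : ℝ} (hr : 0 < r) :
    ∃ L : ℕ, ∀ ξ, ∀ i ∈ shell N r R ξ, ∀ j ∈ shell N r R ξ, j ≤ i + L := by
  have h : ∀ᶠ k in atTop, ‖act (N ^ k)‖ * R < r := by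
    have := hN.tendsto.mul_const R
    rw [zero_mul] at this
    exact this.eventually_lt_const hr
  obtain ⟨L, hL⟩ := eventually_atTop.1 h
  refine ⟨L, fun ξ i hi j hj => ?_⟩
  by_contra! hc
  obtain ⟨k, rfl⟩ := Nat.exists_eq_add_of_lt hc
  have h1 : act (N ^ (i + L + k + 1)) ξ = act (N ^ (L + k + 1)) (act (N ^ i) ξ) := by
    rw [← act_pow_add]; congr 3; ring
  have h2 := hj.1
  rw [h1] at h2
  have h3 := ContinuousLinearMap.le_opNorm (act (N ^ (L + k + 1))) (act (N ^ i) ξ)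
  have h4 := hL (L + k + 1) (by omega)
  have h5 := mul_le_mul_of_nonneg_left hi.2 (norm_nonneg (act (N ^ (L + k + 1))))
  linarith

theorem exists_pow_le_of_shell (hN : PowDecay N) {r R : ℝ} (hr : 0 < r) {a : ℝ} (ha : 0 < a) :
    ∃ K : ℝ, 1 ≤ K ∧ ∀ ξ, ∀ i ∈ shell N r R ξ, ∀ j ∈ shell N r R ξ, a ^ j ≤ K * a ^ i := by
  obtain ⟨L, hL⟩ := exists_shell_diam (R := R) hN hr
  set b := max a a⁻¹ with hb
  have hb1 : 1 ≤ b := by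
    rcases le_total 1 a with h | h
    · exact h.trans (le_max_left _ _)
    · exact ((one_le_inv₀ ha).2 h).trans (le_max_right _ _)
  refine ⟨b ^ L, one_le_pow₀ hb1, fun ξ i hi j hj => ?_⟩
  have h1 := hL ξ i hi j hj
  have h2 := hL ξ j hj i hi
  rcases le_total i j with h | h
  · obtain ⟨k, rfl⟩ := Nat.exists_eq_add_of_le h
    rw [pow_add, mul_comm]
    have : a ^ k ≤ b ^ L := (pow_le_pow_left₀ ha.le (le_max_left _ _) k).trans
      (pow_le_pow_right₀ hb1 (by omega))
    gcongr
  · obtain ⟨k, rfl⟩ := Nat.exists_eq_add_of_le h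
    have : (a⁻¹) ^ k ≤ b ^ L := (pow_le_pow_left₀ (by positivity) (le_max_right _ _) k).trans
      (pow_le_pow_right₀ hb1 (by omega))
    calc a ^ j = a⁻¹ ^ k * a ^ (j + k) := by
          rw [pow_add, inv_pow]; field_simp
      _ ≤ _ := by gcongr

/-- Exponential decay gives `(θ ^ i)⁻¹ ≤ C / r * ‖ξ‖` on the shell, so exponentials in `i` are
polynomial in `ξ`. This keeps the counterexample tempered. -/
theorem exists_pow_le_norm_pow_of_shell (hN : PowDecay N) {r R : ℝ} (hr : 0 < r) {a : ℝ}
    (ha : 0 ≤ a) :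
    ∃ (K : ℝ) (k : ℕ), 0 ≤ K ∧ ∀ ξ, ∀ i ∈ shell N r R ξ, a ^ i ≤ K * ‖ξ‖ ^ k := by
  obtain ⟨C, θ, hC, h0, h1, hb⟩ := hN
  have : ∀ᶠ k : ℕ in atTop, a * θ ^ k < 1 := by
    have := (tendsto_pow_atTop_nhds_zero_of_lt_one h0.le h1).const_mul a
    rw [mul_zero] at this
    exact this.eventually_lt_const one_pos
  obtain ⟨k, hk⟩ := this.exists
  refine ⟨(C / r) ^ k, k, by positivity, fun ξ i hi => ?_⟩
  have h2 : r ≤ C * θ ^ i * ‖ξ‖ := hi.1.trans ((ContinuousLinearMap.le_opNorm _ _).trans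
    (mul_le_mul_of_nonneg_right (hb i) (norm_nonneg _)))
  have h3 : (θ ^ i)⁻¹ ≤ C / r * ‖ξ‖ := by
    rw [inv_le_iff_one_le_mul₀ (by positivity), div_mul_eq_mul_div, div_mul_eq_mul_div,
      le_div_iff₀ hr]
    linarith
  calc a ^ i = (a * θ ^ k) ^ i * ((θ ^ i)⁻¹) ^ k := by
        rw [mul_pow, ← pow_mul, inv_pow, ← pow_mul, mul_comm i k]; field_simp
    _ ≤ 1 * (C / r * ‖ξ‖) ^ k := by
        gcongr
        exact pow_le_one₀ (by positivity) hk.le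
    _ = _ := by rw [one_mul, mul_pow]

/-! ### Frequency supports of the windows -/

theorem norm_le_of_mem_cube {ξ : Space d} (h : ξ ∈ cube d) : ‖ξ‖ ≤ d := by
  rw [EuclideanSpace.norm_eq]
  apply Real.sqrt_le_iff.2
  refine ⟨by positivity, ?_⟩
  calc ∑ k, ‖ξ k‖ ^ 2 ≤ ∑ _k : Fin d, (1 : ℝ) := by
        refine Finset.sum_le_sum fun k _ => ?_
        have := h k
        rw [Real.norm_eq_abs, sq_abs]
        nlinarith [this.1, this.2]
    _ = d := by simp
    _ ≤ (d : ℝ) ^ 2 := by exact_mod_cast Nat.le_self_pow (by norm_num) d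

/-- The function whose dilates are the windows: `Φ` for `i = 0` and `φ` for `i ≥ 1`. -/
def profile (φ Φ : 𝓢(Space d, ℂ)) (i : ℕ) : 𝓢(Space d, ℂ) := if i = 0 then Φ else φ

/-- `r`, `R`, `δ` localize the frequency supports of the windows: a window of index `i` vanishes
on the `δ`-ball about a large frequency `ξ` unless `i` belongs to the shell of `ξ`. -/
def Localizes (A : GL (Fin d) ℝ) (φ Φ : 𝓢(Space d, ℂ)) (r R δ : ℝ) : Prop :=
  ∀ ξ : Space d, R < ‖ξ‖ → ∀ i ∉ shell (A : Matrix (Fin d) (Fin d) ℝ)ᵀ⁻¹ r R ξ,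
    ∀ η : Space d, ‖η‖ ≤ δ →
      (𝓕 (profile φ Φ i) : 𝓢(Space d, ℂ)) (act ((A : Matrix (Fin d) (Fin d) ℝ)ᵀ⁻¹ ^ i) (η + ξ)) = 0

theorem IsAnalyzingPair.exists_localizes {A : GL (Fin d) ℝ} {φ Φ : 𝓢(Space d, ℂ)}
    (h : IsAnalyzingPair A φ Φ) (hN : PowDecay (A : Matrix (Fin d) (Fin d) ℝ)ᵀ⁻¹) :
    ∃ r R δ : ℝ, 0 < r ∧ 0 < δ ∧ Localizes A φ Φ r R δ := by
  obtain ⟨C, hC, hb⟩ := hN.exists_bound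
  have h0 : (0 : Space d) ∉ tsupport (𝓕 φ : 𝓢(Space d, ℂ)) := fun h0 =>
    (h.tsupport_fourier_subset h0).2 rfl
  obtain ⟨r, hr, hball⟩ := Metric.isOpen_iff.1 (isClosed_tsupport _).isOpen_compl 0 h0
  have hφ : ∀ ζ : Space d, (𝓕 φ : 𝓢(Space d, ℂ)) ζ ≠ 0 → r ≤ ‖ζ‖ ∧ ‖ζ‖ ≤ d := fun ζ hζ => by
    have hmem := subset_tsupport _ (Function.mem_support.2 hζ)
    refine ⟨?_, norm_le_of_mem_cube (h.tsupport_fourier_subset hmem).1⟩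
    by_contra! hc
    exact hball (by simpa using hc) hmem
  -- `δ` is chosen so that `N ^ i` moves the `δ`-ball by at most `r / 2`; the annulus is the support
  -- annulus `[r, d]` widened accordingly. The outer radius also puts `ξ + η` outside the support of
  -- `𝓕 Φ`, which settles `i = 0`.
  refine ⟨r / 2, d + r, r / (2 * C), by positivity, by positivity,
    fun ξ hξ i hi η hη => ?_⟩
  set N := (A : Matrix (Fin d) (Fin d) ℝ)ᵀ⁻¹
  by_contra hne
  have hη' : ‖act (N ^ i) η‖ ≤ r / 2 := by
    calc ‖act (N ^ i) η‖ ≤ C * (r / (2 * C)) :=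
          (ContinuousLinearMap.le_of_opNorm_le _ (hb i) _).trans (by gcongr)
      _ = r / 2 := by field_simp
  rw [map_add] at hne
  have h1 := norm_add_le (act (N ^ i) η) (act (N ^ i) ξ)
  have h2 := norm_sub_le (act (N ^ i) η + act (N ^ i) ξ) (act (N ^ i) η)
  rw [add_sub_cancel_left] at h2
  by_cases hi0 : i = 0
  · subst hi0
    rw [profile, if_pos rfl] at hne
    have h3 := norm_le_of_mem_cube (h.tsupport_fourier_subset'
      (subset_tsupport _ (Function.mem_support.2 hne)))
    have h4 : act (N ^ 0) ξ = ξ := by rw [pow_zero, act_one]; rfl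
    rw [h4] at h2 h3 h1
    linarith
  · rw [profile, if_neg hi0] at hne
    have h3 := hφ _ hne
    exact hi ⟨by linarith, by linarith⟩

/-- Beyond radius `d + 1` the function `𝓕 Φ` vanishes, so positivity must come from `φ`. Compactness
makes it uniform on an annulus `K`, into which some power of `N` brings every large `ξ`. -/
theorem IsAnalyzingPair.exists_le_norm_fourier {A : GL (Fin d) ℝ} {φ Φ : 𝓢(Space d, ℂ)}
    (h : IsAnalyzingPair A φ Φ) (hN : PowDecay ((A : Matrix (Fin d) (Fin d) ℝ)ᵀ⁻¹)) :
    ∃ c : ℝ, 0 < c ∧ ∀ᶠ ξ in cobounded (Space d), ∃ i : ℕ, 1 ≤ i ∧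
      c ≤ ‖(𝓕 φ : 𝓢(Space d, ℂ)) (act ((A : Matrix (Fin d) (Fin d) ℝ)ᵀ⁻¹ ^ i) ξ)‖ := by
  set N := (A : Matrix (Fin d) (Fin d) ℝ)ᵀ⁻¹ with hNdef
  set R₀ : ℝ := d + 1
  set R₁ : ℝ := ‖act (A : Matrix (Fin d) (Fin d) ℝ)ᵀ‖ * R₀
  let K : Set (Space d) := Metric.closedBall 0 R₁ ∩ {ξ | R₀ ≤ ‖ξ‖}
  have hK : IsCompact K := (isCompact_closedBall _ _).inter_right
    (isClosed_le continuous_const continuous_norm)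
  have hinv : ∀ ξ, act (A : Matrix (Fin d) (Fin d) ℝ)ᵀ (act N ξ) = ξ := fun ξ => by
    rw [← act_mul_apply, hNdef, Matrix.mul_nonsing_inv, act_one]
    · rfl
    · rw [Matrix.det_transpose]
      exact (Matrix.isUnit_iff_isUnit_det _).1 A.isUnit
  have hKc : ∃ c : ℝ, 0 < c ∧ ∀ ξ ∈ K, ∃ i : ℕ, 1 ≤ i ∧
      c ≤ ‖(𝓕 φ : 𝓢(Space d, ℂ)) (act (N ^ i) ξ)‖ := by
    refine hK.induction_on (p := fun s => ∃ c : ℝ, 0 < c ∧ ∀ ξ ∈ s, ∃ i : ℕ, 1 ≤ i ∧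
      c ≤ ‖(𝓕 φ : 𝓢(Space d, ℂ)) (act (N ^ i) ξ)‖) ⟨1, one_pos, by simp⟩ ?_ ?_ ?_
    · rintro s t hst ⟨c, hc, ht⟩
      exact ⟨c, hc, fun ξ hξ => ht ξ (hst hξ)⟩
    · rintro s t ⟨c, hc, hs⟩ ⟨c', hc', ht⟩
      refine ⟨min c c', lt_min hc hc', ?_⟩
      rintro ξ (hξ | hξ)
      · obtain ⟨i, hi, hci⟩ := hs ξ hξ
        exact ⟨i, hi, (min_le_left _ _).trans hci⟩
      · obtain ⟨i, hi, hci⟩ := ht ξ hξ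
        exact ⟨i, hi, (min_le_right _ _).trans hci⟩
    · intro ξ hξ
      obtain ⟨i, hi, hpos⟩ := h.positive ξ
      have hΦ : (𝓕 Φ : 𝓢(Space d, ℂ)) ξ = 0 := by
        by_contra hne
        have := norm_le_of_mem_cube (h.tsupport_fourier_subset'
          (subset_tsupport _ (Function.mem_support.2 hne)))
        have h2 : (d : ℝ) + 1 ≤ ‖ξ‖ := hξ.2
        linarith
      rw [hΦ, norm_zero, max_eq_left (norm_nonneg _)] at hpos
      have hcont : Continuous fun ξ => ‖(𝓕 φ : 𝓢(Space d, ℂ)) (act (N ^ i) ξ)‖ :=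
        ((𝓕 φ : 𝓢(Space d, ℂ)).continuous.comp (act (N ^ i)).continuous).norm
      refine ⟨_, mem_nhdsWithin_of_mem_nhds (hcont.continuousAt.eventually_const_lt
        (half_lt_self hpos)), _, half_pos hpos, fun ζ hζ => ⟨i, hi, le_of_lt hζ⟩⟩
  obtain ⟨c, hc, hcK⟩ := hKc
  refine ⟨c, hc, ?_⟩
  filter_upwards [tendsto_norm_cobounded_atTop.eventually_ge_atTop R₀] with ξ hξ
  have hR₀ : 0 < R₀ := by positivity
  have hex := ((hN.tendsto_apply ξ).eventually_lt_const hR₀).exists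
  classical
  -- The orbit point just before the first entry into the ball of radius `R₀` lies in `K`: one
  -- application of `Aᵀ` enlarges norms by at most the factor in `R₁`.
  have hfind := Nat.find_spec hex
  obtain ⟨m, hm⟩ : ∃ m, Nat.find hex = m + 1 := by
    refine Nat.exists_eq_succ_of_ne_zero fun h0 => ?_
    rw [h0, pow_zero, act_one] at hfind
    exact absurd hξ (not_le.2 hfind)
  have hmin : R₀ ≤ ‖act (N ^ m) ξ‖ := not_lt.1 (Nat.find_min hex (by omega))
  have hmem : act (N ^ m) ξ ∈ K := by
    refine ⟨?_, hmin⟩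
    rw [mem_closedBall_zero_iff, ← hinv (act (N ^ m) ξ), ← act_mul_apply N, ← pow_succ', ← hm]
    exact (ContinuousLinearMap.le_opNorm _ _).trans
      (mul_le_mul_of_nonneg_left hfind.le (norm_nonneg _))
  obtain ⟨i, hi, hci⟩ := hcK _ hmem
  exact ⟨i + m, by omega, by rwa [act_pow_add]⟩

/-! ### Homogeneous quasi-norms and the reduction to shells -/

theorem PowDecay.abs_det_lt_one [NeZero d] {N : Matrix (Fin d) (Fin d) ℝ} (hN : PowDecay N) :
    |N.det| < 1 := by
  have h1 : Tendsto (fun i : ℕ => N ^ i) atTop (𝓝 0) := by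
    refine tendsto_pi_nhds.2 fun k => tendsto_pi_nhds.2 fun l => ?_
    refine squeeze_zero_norm (fun i => ?_) (hN.tendsto_apply (EuclideanSpace.single l (1 : ℝ)))
    have : (N ^ i) k l = act (N ^ i) (EuclideanSpace.single l (1 : ℝ)) k := by
      simp [act_apply]
    rw [this]
    exact PiLp.norm_apply_le _ k
  have h2 := (Continuous.matrix_det continuous_id).continuousAt.tendsto.comp h1
  have h3 : (Matrix.det (0 : Matrix (Fin d) (Fin d) ℝ)) = 0 := Matrix.det_zero
  simp only [Function.comp_def, id, h3, Matrix.det_pow] at h2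
  exact tendsto_pow_atTop_nhds_zero_iff.1 h2

namespace IsHomogeneousQuasiNorm

variable {M : Matrix (Fin d) (Fin d) ℝ} {ρ : Space d → ℝ}

/-- Steinhaus: some sublevel set has positive measure, so its difference set contains a ball about
`0`. As `ρ` need not be even, the sets `E n` also control `ρ (-x)`. -/
theorem exists_le_of_norm_lt (h : IsHomogeneousQuasiNorm M ρ) :
    ∃ C δ : ℝ, 0 ≤ C ∧ 0 < δ ∧ ∀ x, ‖x‖ < δ → ρ x ≤ C := by
  obtain ⟨C, hC, htri⟩ := h.triangle
  let E : ℕ → Set (Space d) := fun n => {x | ρ x ≤ n ∧ ρ (-x) ≤ n}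
  have hE : ∀ n, NullMeasurableSet (E n) volume := fun n => by
    have h1 : NullMeasurableSet {x | ρ x ≤ n} volume := h.measurable measurableSet_Iic
    refine h1.inter ?_
    exact h1.preimage
      (Measure.measurePreserving_neg (volume : Measure (Space d))).quasiMeasurePreserving
  have hU : ⋃ n, E n = Set.univ := Set.eq_univ_of_forall fun x => by
    obtain ⟨n, hn⟩ := exists_nat_ge (max (ρ x) (ρ (-x)))
    exact Set.mem_iUnion.2 ⟨n, (le_max_left _ _).trans hn, (le_max_right _ _).trans hn⟩
  obtain ⟨n, hn⟩ : ∃ n, volume (E n) ≠ 0 := by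
    by_contra! hc
    have := measure_iUnion_null hc
    rw [hU] at this
    exact (NeZero.ne (volume : Measure (Space d))) (Measure.measure_univ_eq_zero.1 this)
  obtain ⟨t, htE, htm, hte⟩ := (hE n).exists_measurable_subset_ae_eq
  have ht : 0 < volume t := by rw [measure_congr hte]; exact pos_iff_ne_zero.2 hn
  obtain ⟨δ, hδ, hball⟩ := Metric.mem_nhds_iff.1
    (Measure.sub_mem_nhds_zero_of_addHaar_pos (volume : Measure (Space d)) t htm ht)
  refine ⟨C * (n + n), δ, by positivity, hδ, fun x hx => ?_⟩
  obtain ⟨a, ha, b, hb, rfl⟩ := Set.mem_sub.1 (hball (by simpa using hx))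
  rw [sub_eq_add_neg]
  refine (htri _ _).trans ?_
  have := (htE ha).1
  have := (htE hb).2
  gcongr

theorem dilation_pow (h : IsHomogeneousQuasiNorm M ρ) (i : ℕ) (x : Space d) :
    ρ (act (M ^ i) x) = |M.det| ^ i * ρ x := by
  induction i with
  | zero => simp [act_one]
  | succ i ih => rw [pow_succ', act_mul_apply, h.dilation, ih]; ring

theorem eq_dilation_inv (h : IsHomogeneousQuasiNorm M ρ) (hM : IsUnit M) (i : ℕ) (x : Space d) :
    ρ x = |M.det| ^ i * ρ (act (M⁻¹ ^ i) x) := by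
  have hd := (Matrix.isUnit_iff_isUnit_det _).1 hM
  have hcomm : Commute M M⁻¹ :=
    (Matrix.mul_nonsing_inv _ hd).trans (Matrix.nonsing_inv_mul _ hd).symm
  rw [← h.dilation_pow, ← act_mul_apply, ← hcomm.mul_pow,
    Matrix.mul_nonsing_inv _ hd, one_pow, act_one]
  rfl

theorem exists_le_of_norm_le (h : IsHomogeneousQuasiNorm M ρ) (hM : IsUnit M)
    (hN : PowDecay M⁻¹) (R : ℝ) : ∃ C : ℝ, 0 < C ∧ ∀ x, ‖x‖ ≤ R → ρ x ≤ C := by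
  obtain ⟨C, δ, hC, hδ, hb⟩ := h.exists_le_of_norm_lt
  have h1 := hN.tendsto.mul_const R
  rw [zero_mul] at h1
  obtain ⟨i, hi⟩ := (h1.eventually_lt_const hδ).exists
  refine ⟨|M.det| ^ i * C + 1, by positivity, fun x hx => ?_⟩
  rw [h.eq_dilation_inv hM i]
  have := hb (act (M⁻¹ ^ i) x) (lt_of_le_of_lt ((ContinuousLinearMap.le_opNorm _ _).trans
    (mul_le_mul_of_nonneg_left hx (norm_nonneg _))) hi)
  have := mul_le_mul_of_nonneg_left this (pow_nonneg (abs_nonneg M.det) i)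
  linarith

theorem tendsto_zero [NeZero d] (h : IsHomogeneousQuasiNorm M ρ) (hM : IsUnit M)
    (hN : PowDecay M⁻¹) : Tendsto ρ (𝓝 0) (𝓝 0) := by
  obtain ⟨C, δ, hC, hδ, hb⟩ := h.exists_le_of_norm_lt
  have hd := (Matrix.isUnit_iff_isUnit_det _).1 hM
  have hdet : |M.det| ≠ 0 := abs_ne_zero.2 hd.ne_zero
  have hlt := hN.abs_det_lt_one
  rw [Matrix.det_nonsing_inv, Ring.inverse_eq_inv', abs_inv] at hlt
  rw [Metric.tendsto_nhds]
  intro ε hε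
  have h1 := (tendsto_pow_atTop_nhds_zero_of_lt_one (by positivity) hlt).mul_const C
  rw [zero_mul] at h1
  obtain ⟨i, hi⟩ := (h1.eventually_lt_const hε).exists
  have h2 : Tendsto (fun x => ‖act (M ^ i) x‖) (𝓝 0) (𝓝 0) := by
    have := (act (M ^ i)).continuous.norm.tendsto 0
    simpa using this
  filter_upwards [h2.eventually_lt_const hδ] with x hx
  rw [Real.dist_eq, sub_zero, abs_of_nonneg (h.nonneg x)]
  have h3 := hb _ hx
  rw [h.dilation_pow] at h3
  refine lt_of_le_of_lt ?_ hi
  rw [inv_pow, ← div_eq_inv_mul, le_div_iff₀' (by positivity)]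
  exact h3

/-- `ρ` need not be continuous, so it need not attain a minimum. Local lower bounds suffice for
compactness: in `ρ x ≤ C * (ρ y + ρ (x - y))` the last term is small for `y` near `x`. -/
theorem exists_le_of_annulus [NeZero d] (h : IsHomogeneousQuasiNorm M ρ) (hM : IsUnit M)
    (hN : PowDecay M⁻¹) {r : ℝ} (hr : 0 < r) (R : ℝ) :
    ∃ c : ℝ, 0 < c ∧ ∀ x, r ≤ ‖x‖ → ‖x‖ ≤ R → c ≤ ρ x := by
  obtain ⟨C, hC, htri⟩ := h.triangle
  let K : Set (Space d) := Metric.closedBall 0 R ∩ {ξ | r ≤ ‖ξ‖}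
  have hK : IsCompact K := (isCompact_closedBall _ _).inter_right
    (isClosed_le continuous_const continuous_norm)
  have hKc : ∃ c : ℝ, 0 < c ∧ ∀ x ∈ K, c ≤ ρ x := by
    refine hK.induction_on (p := fun s => ∃ c : ℝ, 0 < c ∧ ∀ x ∈ s, c ≤ ρ x)
      ⟨1, one_pos, by simp⟩ ?_ ?_ ?_
    · rintro s t hst ⟨c, hc, ht⟩
      exact ⟨c, hc, fun x hx => ht x (hst hx)⟩
    · rintro s t ⟨c, hc, hs⟩ ⟨c', hc', ht⟩
      refine ⟨min c c', lt_min hc hc', ?_⟩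
      rintro x (hx | hx)
      · exact (min_le_left _ _).trans (hs x hx)
      · exact (min_le_right _ _).trans (ht x hx)
    · intro x hx
      have hx0 : x ≠ 0 := norm_pos_iff.1 (hr.trans_le hx.2)
      have hρ : 0 < ρ x := (h.nonneg x).lt_of_ne' fun h0 => hx0 ((h.eq_zero_iff x).1 h0)
      have hsub : Tendsto (fun y => x - y) (𝓝 x) (𝓝 0) := by
        have : Continuous fun y : Space d => x - y := by fun_prop
        simpa using this.tendsto x
      have h1 := ((h.tendsto_zero hM hN).comp hsub).eventually_lt_const
        (show 0 < ρ x / (2 * C) by positivity)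
      refine ⟨_, mem_nhdsWithin_of_mem_nhds h1, ρ x / (2 * C), by positivity, fun y hy => ?_⟩
      have h2 := htri y (x - y)
      rw [add_sub_cancel] at h2
      have h3 : ρ (x - y) < ρ x / (2 * C) := hy
      have h4 : C * (ρ x / (2 * C)) = ρ x / 2 := by field_simp
      have h5 : C * ρ (x - y) < ρ x / 2 := by
        rw [← h4]; exact mul_lt_mul_of_pos_left h3 hC
      rw [div_le_iff₀ (by positivity)]
      linarith
  obtain ⟨c, hc, hcK⟩ := hKc
  exact ⟨c, hc, fun x h1 h2 => hcK x ⟨by simpa using h2, h1⟩⟩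

theorem exists_shell_bounds [NeZero d] (h : IsHomogeneousQuasiNorm M ρ) (hM : IsUnit M)
    (hN : PowDecay M⁻¹) {r : ℝ} (hr : 0 < r) (R : ℝ) :
    ∃ C : ℝ, 0 < C ∧ ∀ ξ, ∀ i ∈ shell M⁻¹ r R ξ,
      |M.det| ^ i ≤ C * ρ ξ ∧ ρ ξ ≤ C * |M.det| ^ i := by
  obtain ⟨C, hC, hCb⟩ := h.exists_le_of_norm_le hM hN R
  obtain ⟨c, hc, hcb⟩ := h.exists_le_of_annulus hM hN hr R
  refine ⟨max C c⁻¹, lt_max_of_lt_left hC, fun ξ i hi => ?_⟩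
  have h1 := h.eq_dilation_inv hM i ξ
  have hp : 0 ≤ |M.det| ^ i := by positivity
  constructor
  · calc |M.det| ^ i = c⁻¹ * (|M.det| ^ i * c) := by field_simp
      _ ≤ c⁻¹ * ρ ξ := by rw [h1]; gcongr; exact hcb _ hi.1 hi.2
      _ ≤ _ := by gcongr; exacts [h.nonneg ξ, le_max_right _ _]
  · calc ρ ξ = ρ (act (M⁻¹ ^ i) ξ) * |M.det| ^ i := by rw [h1, mul_comm]
      _ ≤ _ := by gcongr; exact (hCb _ hi.2).trans (le_max_left _ _)

end IsHomogeneousQuasiNorm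

theorem coarselyEquivalent_of_shell [NeZero d] {M M' : Matrix (Fin d) (Fin d) ℝ}
    (hM : IsUnit M) (hM' : IsUnit M') (hN : PowDecay M⁻¹) (hN' : PowDecay M'⁻¹)
    {r R r' R' K : ℝ} (hr : 0 < r) (hr' : 0 < r') (hK : 0 < K)
    (h : ∀ᶠ ξ in cobounded (Space d), ∃ i ∈ shell M⁻¹ r R ξ, ∃ j ∈ shell M'⁻¹ r' R' ξ,
      |M.det| ^ i ≤ K * |M'.det| ^ j ∧ |M'.det| ^ j ≤ K * |M.det| ^ i) :
    CoarselyEquivalent M M' := by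
  intro ρ ρ' hρ hρ'
  obtain ⟨C, hC, hb⟩ := hρ.exists_shell_bounds hM hN hr R
  obtain ⟨C', hC', hb'⟩ := hρ'.exists_shell_bounds hM' hN' hr' R'
  rw [← comap_norm_atTop, eventually_comap] at h
  obtain ⟨T, hT⟩ := eventually_atTop.1 h
  obtain ⟨D, hD, hDb⟩ := hρ.exists_le_of_norm_le hM hN T
  obtain ⟨D', hD', hDb'⟩ := hρ'.exists_le_of_norm_le hM' hN' T
  have hE : 0 < C * C' * K := by positivity
  -- The additive constant only serves the ball `‖x‖ ≤ T`, where both quasi-norms are bounded.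
  refine ⟨C * C' * K, D' + 1 / (C * C' * K) * D, hE, by positivity, fun x => ?_⟩
  rcases le_total T ‖x‖ with hx | hx
  · obtain ⟨i, hi, j, hj, h1, h2⟩ := hT _ hx x rfl
    obtain ⟨h3, h4⟩ := hb x i hi
    obtain ⟨h5, h6⟩ := hb' x j hj
    have h7 : ρ x ≤ (C * C' * K) * ρ' x := by
      calc ρ x ≤ C * (K * (C' * ρ' x)) := h4.trans (by gcongr; exact h1.trans (by gcongr))
        _ = _ := by ring
    have h8 : ρ' x ≤ (C * C' * K) * ρ x := by
      calc ρ' x ≤ C' * (K * (C * ρ x)) := h6.trans (by gcongr; exact h2.trans (by gcongr))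
        _ = _ := by ring
    have h9 : 1 / (C * C' * K) * ρ x ≤ ρ' x := by
      rw [one_div, inv_mul_le_iff₀ hE]; exact h7
    have : 0 ≤ D' + 1 / (C * C' * K) * D := by positivity
    constructor <;> linarith
  · have h1 := hDb x hx
    have h2 := hDb' x hx
    have h3 := hρ.nonneg x
    have h4 := hρ'.nonneg x
    have h5 : 1 / (C * C' * K) * ρ x ≤ 1 / (C * C' * K) * D := by gcongr
    have h6 : 0 ≤ 1 / (C * C' * K) * D := by positivity
    have h7 : 0 ≤ C * C' * K * ρ x := by positivity
    constructor <;> linarith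

/-! ### Lacunary sums of modulated waves and their convolutions -/

theorem exists_temperedDistribution_tsum_eval (c : ℕ → ℂ) (ξ : ℕ → Space d) (w : ℕ → ℝ) (k : ℕ)
    (hw : Summable w) (h : ∀ n, ‖c n‖ ≤ w n * ‖ξ n‖ ^ k) :
    ∃ D : 𝓢'(Space d, ℂ), ∀ u : 𝓢(Space d, ℂ), D u = ∑' n, c n * u (ξ n) := by
  have hb : ∀ (u : 𝓢(Space d, ℂ)) n, ‖c n * u (ξ n)‖ ≤ |w n| * SchwartzMap.seminorm ℂ k 0 u := by
    intro u n
    rw [norm_mul]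
    calc ‖c n‖ * ‖u (ξ n)‖ ≤ |w n| * ‖ξ n‖ ^ k * ‖u (ξ n)‖ := by
          gcongr
          exact (h n).trans (by gcongr; exact le_abs_self _)
      _ = |w n| * (‖ξ n‖ ^ k * ‖u (ξ n)‖) := by ring
      _ ≤ _ := by
          gcongr
          exact SchwartzMap.norm_pow_mul_le_seminorm ℂ u k (ξ n)
  have hs : ∀ u : 𝓢(Space d, ℂ), Summable fun n => c n * u (ξ n) := fun u =>
    Summable.of_norm_bounded (hw.abs.mul_right _) (hb u)
  let L : 𝓢(Space d, ℂ) →L[ℂ] ℂ := SchwartzMap.mkCLMtoNormedSpace (σ := RingHom.id ℂ)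
    (fun u => ∑' n, c n * u (ξ n))
    (fun u v => by
      rw [← (hs u).tsum_add (hs v)]
      exact tsum_congr fun n => by simp [mul_add])
    (fun a u => by
      rw [RingHom.id_apply, smul_eq_mul, ← tsum_mul_left]
      refine tsum_congr fun n => ?_
      simp only [smul_apply, smul_eq_mul]
      ring)
    ⟨{(k, 0)}, ∑' n, |w n|, tsum_nonneg fun n => abs_nonneg _, fun u => by
      rw [Finset.sup_singleton, SchwartzMap.schwartzSeminormFamily_apply, ← tsum_mul_right]
      exact tsum_of_norm_bounded (hw.abs.mul_right _).hasSum (hb u)⟩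
  exact ⟨ContinuousLinearMap.toPointwiseConvergenceCLM _ _ _ _ L, fun u => rfl⟩

/-- The distribution is `g` times the inverse Fourier transform of the point masses `c n` at `ξ n`.
-/
theorem exists_temperedDistribution_tsum_wave (g : 𝓢(Space d, ℂ)) (c : ℕ → ℂ) (ξ : ℕ → Space d)
    (w : ℕ → ℝ) (k : ℕ) (hw : Summable w) (h : ∀ n, ‖c n‖ ≤ w n * ‖ξ n‖ ^ k) :
    ∃ f : 𝓢'(Space d, ℂ), ∀ u : 𝓢(Space d, ℂ),
      f u = ∑' n, c n * ∫ y, Real.fourierChar (inner ℝ y (ξ n)) • (g y * u y) := by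
  obtain ⟨D, hD⟩ := exists_temperedDistribution_tsum_eval c ξ w k hw h
  refine ⟨TemperedDistribution.smulLeftCLM ℂ g (𝓕⁻ D), fun u => ?_⟩
  rw [TemperedDistribution.smulLeftCLM_apply_apply, TemperedDistribution.fourierInv_apply, hD]
  refine tsum_congr fun n => ?_
  rw [SchwartzMap.fourierInv_coe, Real.fourierInv_eq,
    SchwartzMap.smulLeftCLM_apply g.hasTemperateGrowth]
  rfl

/-- The convolution of `y ↦ exp (2πi y·ξ) g(y)` with the `L¹`-normalized dilate of `χ` whose
inverse dilation is `L`. -/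
def waveConv (g χ : 𝓢(Space d, ℂ)) (L : Space d →L[ℝ] Space d) (ξ x : Space d) : ℂ :=
  ∫ u, Real.fourierChar (inner ℝ (x - L u) ξ) • (g (x - L u) * χ u)

theorem integral_comp_dilation {E : Type*} [NormedAddCommGroup E] [NormedSpace ℝ E]
    (M : Matrix (Fin d) (Fin d) ℝ) (hM : M.det ≠ 0) (F : Space d → E) :
    ∫ y, |M.det| • F (act M y) = ∫ u, F u := by
  have hdet : LinearMap.det (act M : Space d →ₗ[ℝ] Space d) = M.det := by
    have : (act M : Space d →ₗ[ℝ] Space d) = Matrix.toLin (EuclideanSpace.basisFun (Fin d) ℝ).toBasis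
      (EuclideanSpace.basisFun (Fin d) ℝ).toBasis M := rfl
    rw [this, LinearMap.det_toLin]
  let e : Space d ≃L[ℝ] Space d :=
    (LinearEquiv.ofIsUnitDet (f := (act M : Space d →ₗ[ℝ] Space d))
      (v := (EuclideanSpace.basisFun (Fin d) ℝ).toBasis)
      (v' := (EuclideanSpace.basisFun (Fin d) ℝ).toBasis) (by
        rw [LinearMap.det_toMatrix, hdet]; exact hM.isUnit)).toContinuousLinearEquiv
  have he : ∀ y, e y = act M y := fun y => rfl
  have hmap := Measure.map_linearMap_addHaar_eq_smul_addHaar (volume : Measure (Space d))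
    (f := (act M : Space d →ₗ[ℝ] Space d)) (by rw [hdet]; exact hM)
  have h1 : ∫ y, F (act M y) = ∫ u, F u ∂(Measure.map (act M) volume) :=
    (e.toHomeomorph.measurableEmbedding.integral_map F).symm
  have h2 : Measure.map (act M) (volume : Measure (Space d)) =
      ENNReal.ofReal |(M.det)⁻¹| • volume := by
    rw [← hdet]; exact hmap
  rw [integral_smul, h1, h2, integral_smul_measure, ENNReal.toReal_ofReal (abs_nonneg _), smul_smul,
    abs_inv, mul_inv_cancel₀ (abs_ne_zero.2 hM), one_smul]

theorem conv_window_of_tsum_wave (A : GL (Fin d) ℝ) (φ Φ g : 𝓢(Space d, ℂ)) (c : ℕ → ℂ)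
    (ξ : ℕ → Space d) (f : 𝓢'(Space d, ℂ))
    (hf : ∀ u : 𝓢(Space d, ℂ),
      f u = ∑' n, c n * ∫ y, Real.fourierChar (inner ℝ y (ξ n)) • (g y * u y))
    (i : ℕ) (x : Space d) :
    conv f (window A φ Φ i) x = ∑' n, c n *
      waveConv g (profile φ Φ i) (act ((A : Matrix (Fin d) (Fin d) ℝ)⁻¹ ^ i)) (ξ n) x := by
  rw [conv, hf]
  refine tsum_congr fun n => ?_
  congr 1
  have hd : (A : Matrix (Fin d) (Fin d) ℝ).det ≠ 0 :=
    ((Matrix.isUnit_iff_isUnit_det _).1 A.isUnit).ne_zero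
  have hcomm : Commute (A : Matrix (Fin d) (Fin d) ℝ)⁻¹ (A : Matrix (Fin d) (Fin d) ℝ) :=
    (Matrix.nonsing_inv_mul _ hd.isUnit).trans (Matrix.mul_nonsing_inv _ hd.isUnit).symm
  have hwin : ∀ y, window A φ Φ i y = ((|((A : Matrix (Fin d) (Fin d) ℝ) ^ i).det| : ℝ) : ℂ) *
      profile φ Φ i (act ((A : Matrix (Fin d) (Fin d) ℝ) ^ i) y) := fun y => by
    by_cases hi : i = 0
    · subst hi
      simp [window, profile, act_one]
    · rw [window, profile, if_neg hi, if_neg hi, dilate_apply, Matrix.det_pow, abs_pow]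
  have hinv : ∀ y, act ((A : Matrix (Fin d) (Fin d) ℝ)⁻¹ ^ i)
      (act ((A : Matrix (Fin d) (Fin d) ℝ) ^ i) y) = y := fun y => by
    rw [← act_mul_apply, ← hcomm.mul_pow, Matrix.nonsing_inv_mul _ hd.isUnit, one_pow, act_one]
    rfl
  refine (integral_sub_left_eq_self _ volume x).symm.trans (Eq.trans ?_
    (integral_comp_dilation ((A : Matrix (Fin d) (Fin d) ℝ) ^ i)
      (by rw [Matrix.det_pow]; exact pow_ne_zero _ hd) _))
  refine integral_congr_ae (Eventually.of_forall fun y => ?_)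
  simp only [reflectAt_apply, sub_sub_cancel, hwin, hinv, Circle.smul_def, smul_eq_mul,
    Complex.real_smul]
  ring

/-- Fubini. On the Fourier side only frequencies in the support of `b` shifted by `ξ` meet the
window, so disjoint supports give zero. -/
theorem waveConv_fourierInv (b χ : 𝓢(Space d, ℂ)) (Q : Matrix (Fin d) (Fin d) ℝ) (ξ x : Space d) :
    waveConv (𝓕⁻ b) χ (act Q) ξ x = ∫ η, Real.fourierChar (inner ℝ x (η + ξ)) •
      (b η * (𝓕 χ : 𝓢(Space d, ℂ)) (act Qᵀ (η + ξ))) := by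
  let F : Space d → Space d → ℂ := fun u η =>
    Real.fourierChar (inner ℝ (x - act Q u) (η + ξ)) • (b η * χ u)
  have hF : Integrable (Function.uncurry F) (volume.prod volume) := by
    have h1 : Integrable (fun z : Space d × Space d => χ z.1 * b z.2) (volume.prod volume) :=
      χ.integrable.mul_prod b.integrable
    refine h1.norm.mono' ?_ (Eventually.of_forall fun z => ?_)
    · refine Continuous.aestronglyMeasurable ?_
      have := b.continuous
      have := χ.continuous
      simp only [F, Function.uncurry_def, Circle.smul_def]
      fun_prop
    · simp only [F, Function.uncurry_def, Circle.norm_smul, norm_mul]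
      rw [mul_comm]
  have h1 : waveConv (𝓕⁻ b) χ (act Q) ξ x = ∫ u, ∫ η, F u η := by
    refine integral_congr_ae (Eventually.of_forall fun u => ?_)
    simp only [F]
    rw [SchwartzMap.fourierInv_coe, Real.fourierInv_eq]
    simp only [Circle.smul_def, smul_eq_mul]
    rw [← integral_mul_const, ← integral_const_mul]
    refine integral_congr_ae (Eventually.of_forall fun η => ?_)
    simp only [inner_add_right, AddChar.map_add_eq_mul, Circle.coe_mul,
      real_inner_comm (x - act Q u) η]
    ring
  rw [h1, integral_integral_swap hF]
  refine integral_congr_ae (Eventually.of_forall fun η => ?_)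
  simp only [F]
  rw [SchwartzMap.fourier_coe, Real.fourier_eq]
  simp only [Circle.smul_def, smul_eq_mul]
  rw [← integral_const_mul, ← integral_const_mul]
  refine integral_congr_ae (Eventually.of_forall fun u => ?_)
  have h2 : inner ℝ (x - act Q u) (η + ξ) =
      inner ℝ x (η + ξ) + -inner ℝ u (act Qᵀ (η + ξ)) := by
    rw [inner_sub_left, real_inner_comm (act Qᵀ (η + ξ)) u, inner_act_transpose,
      real_inner_comm (act Q u)]
    ring
  simp only [h2, AddChar.map_add_eq_mul, Circle.coe_mul]
  ring

theorem waveConv_eq_zero (b χ : 𝓢(Space d, ℂ)) (Q : Matrix (Fin d) (Fin d) ℝ) (ξ x : Space d)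
    (δ : ℝ) (hb : ∀ η, b η ≠ 0 → ‖η‖ ≤ δ)
    (h : ∀ η : Space d, ‖η‖ ≤ δ → (𝓕 χ : 𝓢(Space d, ℂ)) (act Qᵀ (η + ξ)) = 0) :
    waveConv (𝓕⁻ b) χ (act Q) ξ x = 0 := by
  rw [waveConv_fourierInv]
  refine integral_eq_zero_of_ae (Eventually.of_forall fun η => ?_)
  by_cases hη : b η = 0
  · simp [hη]
  · beta_reduce
    rw [h η (hb η hη), mul_zero, smul_zero]
    rfl

theorem exists_one_add_norm_pow_mul_le (g : 𝓢(Space d, ℂ)) (m : ℕ) :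
    ∃ C : ℝ, 0 ≤ C ∧ ∀ y, (1 + ‖y‖) ^ m * ‖g y‖ ≤ C := by
  refine ⟨2 ^ m * (Finset.Iic (m, 0)).sup (fun n => SchwartzMap.seminorm ℂ n.1 n.2) g,
    by positivity, fun y => ?_⟩
  have := SchwartzMap.one_add_le_sup_seminorm_apply (𝕜 := ℂ) (m := (m, 0)) le_rfl le_rfl g y
  simpa using this

/-- The weight splits as `1 + ‖x‖ ≤ (1 + ‖x - L u‖) * (K * (1 + ‖u‖))`, each factor being absorbed
by one Schwartz function. Arbitrary `m` is needed to reach `L^p` for small `p`. -/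
theorem exists_norm_waveConv_le (g χ : 𝓢(Space d, ℂ)) (m : ℕ) {K : ℝ} (hK : 1 ≤ K) :
    ∃ C : ℝ, 0 ≤ C ∧ ∀ L : Space d →L[ℝ] Space d, ‖L‖ ≤ K → ∀ ξ x,
      ‖waveConv g χ L ξ x‖ ≤ C * ((1 + ‖x‖) ^ m)⁻¹ := by
  obtain ⟨C, hC, hb⟩ := exists_one_add_norm_pow_mul_le g m
  have hint : Integrable (fun u => (1 + ‖u‖) ^ m * ‖χ u‖) (volume : Measure (Space d)) := by
    have h1 : Integrable (fun u : Space d => 2 ^ m * (‖χ u‖ + ‖u‖ ^ m * ‖χ u‖)) volume :=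
      (χ.integrable.norm.add (χ.integrable_pow_mul volume m)).const_mul _
    refine h1.mono' ?_ (Eventually.of_forall fun u => ?_)
    · have := χ.continuous
      exact Continuous.aestronglyMeasurable (by fun_prop)
    · rw [Real.norm_of_nonneg (by positivity)]
      have h2 : (1 + ‖u‖) ^ m ≤ 2 ^ m * (1 + ‖u‖ ^ m) := by
        have h3 : (1 + ‖u‖) ^ m ≤ (2 * max 1 ‖u‖) ^ m := by
          gcongr
          linarith [le_max_left 1 ‖u‖, le_max_right 1 ‖u‖]
        refine h3.trans ?_
        rw [mul_pow]
        gcongr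
        rcases le_total 1 ‖u‖ with h | h
        · rw [max_eq_right h]; linarith
        · rw [max_eq_left h, one_pow]; have : 0 ≤ ‖u‖ ^ m := by positivity
          linarith
      calc (1 + ‖u‖) ^ m * ‖χ u‖ ≤ 2 ^ m * (1 + ‖u‖ ^ m) * ‖χ u‖ := by gcongr
        _ = _ := by ring
  refine ⟨C * K ^ m * ∫ u, (1 + ‖u‖) ^ m * ‖χ u‖, by positivity, fun L hL ξ x => ?_⟩
  have hpt : ∀ u, ‖Real.fourierChar (inner ℝ (x - L u) ξ) • (g (x - L u) * χ u)‖ ≤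
      (C * K ^ m * ((1 + ‖x‖) ^ m)⁻¹) * ((1 + ‖u‖) ^ m * ‖χ u‖) := by
    intro u
    rw [Circle.norm_smul, norm_mul]
    have h1 : 1 + ‖x‖ ≤ (1 + ‖x - L u‖) * (K * (1 + ‖u‖)) := by
      have h2 : ‖x‖ ≤ ‖x - L u‖ + ‖L u‖ := by
        simpa using norm_add_le (x - L u) (L u)
      have h3 : ‖L u‖ ≤ K * ‖u‖ := L.le_of_opNorm_le hL u
      have h4 : 0 ≤ ‖u‖ := norm_nonneg _
      have h5 : 0 ≤ ‖x - L u‖ := norm_nonneg _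
      have h6 : 0 ≤ K * ‖u‖ := by positivity
      have h7 : 0 ≤ ‖x - L u‖ * (K * (1 + ‖u‖) - 1) := by
        refine mul_nonneg h5 ?_; linarith
      nlinarith
    have h8 : (1 + ‖x‖) ^ m * ‖g (x - L u)‖ ≤ C * (K * (1 + ‖u‖)) ^ m := by
      calc (1 + ‖x‖) ^ m * ‖g (x - L u)‖
          ≤ ((1 + ‖x - L u‖) * (K * (1 + ‖u‖))) ^ m * ‖g (x - L u)‖ := by gcongr
        _ = ((1 + ‖x - L u‖) ^ m * ‖g (x - L u)‖) * (K * (1 + ‖u‖)) ^ m := by rw [mul_pow]; ring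
        _ ≤ _ := by gcongr; exact hb _
    have h9 : ‖g (x - L u)‖ ≤ C * (K * (1 + ‖u‖)) ^ m * ((1 + ‖x‖) ^ m)⁻¹ := by
      rw [← div_eq_mul_inv, le_div_iff₀ (by positivity), mul_comm]; exact h8
    calc ‖g (x - L u)‖ * ‖χ u‖ ≤ C * (K * (1 + ‖u‖)) ^ m * ((1 + ‖x‖) ^ m)⁻¹ * ‖χ u‖ := by gcongr
      _ = _ := by rw [mul_pow]; ring
  calc ‖waveConv g χ L ξ x‖ ≤ ∫ u, (C * K ^ m * ((1 + ‖x‖) ^ m)⁻¹) * ((1 + ‖u‖) ^ m * ‖χ u‖) :=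
        norm_integral_le_of_norm_le (hint.const_mul _) (Eventually.of_forall hpt)
    _ = _ := by rw [integral_const_mul]; ring

theorem exists_norm_sub_le (g : 𝓢(Space d, ℂ)) :
    ∃ C : ℝ, 0 ≤ C ∧ ∀ x y, ‖g x - g y‖ ≤ C * ‖x - y‖ := by
  refine ⟨SchwartzMap.seminorm ℂ 0 1 g, by positivity, fun x y => ?_⟩
  refine Convex.norm_image_sub_le_of_norm_fderiv_le (𝕜 := ℝ) (s := Set.univ)
    (fun z _ => g.differentiableAt) (fun z _ => ?_) convex_univ trivial trivial
  rw [← norm_iteratedFDeriv_one]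
  exact SchwartzMap.norm_iteratedFDeriv_le_seminorm ℂ g 1 z

/-- Replacing `g (x - Q u)` by `g x` turns the integral into a unimodular multiple of `g x * 𝓕 χ (Qᵀ
ξ)`; the error is at most the Lipschitz constant of `g` times `‖Q‖` and the first moment of `χ`. -/
theorem exists_le_norm_waveConv (g χ : 𝓢(Space d, ℂ)) :
    ∃ C : ℝ, 0 ≤ C ∧ ∀ (Q : Matrix (Fin d) (Fin d) ℝ) (ξ x : Space d),
      ‖g x‖ * ‖(𝓕 χ : 𝓢(Space d, ℂ)) (act Qᵀ ξ)‖ - C * ‖act Q‖ ≤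
        ‖waveConv g χ (act Q) ξ x‖ := by
  obtain ⟨C, hC, hb⟩ := exists_norm_sub_le g
  have hint : Integrable (fun u => ‖u‖ * ‖χ u‖) (volume : Measure (Space d)) := by
    simpa using χ.integrable_pow_mul volume 1
  refine ⟨C * ∫ u, ‖u‖ * ‖χ u‖, by positivity, fun Q ξ x => ?_⟩
  have h1 : ∫ u, Real.fourierChar (inner ℝ (x - act Q u) ξ) • (g x * χ u) =
      Real.fourierChar (inner ℝ x ξ) • (g x * (𝓕 χ : 𝓢(Space d, ℂ)) (act Qᵀ ξ)) := by
    rw [SchwartzMap.fourier_coe, Real.fourier_eq]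
    simp only [Circle.smul_def, smul_eq_mul]
    rw [← integral_const_mul, ← integral_const_mul]
    refine integral_congr_ae (Eventually.of_forall fun u => ?_)
    have h2 : inner ℝ (x - act Q u) ξ = inner ℝ x ξ + -inner ℝ u (act Qᵀ ξ) := by
      rw [inner_sub_left, real_inner_comm (act Qᵀ ξ) u, inner_act_transpose,
        real_inner_comm (act Q u)]
      ring
    simp only [h2, AddChar.map_add_eq_mul, Circle.coe_mul]
    ring
  have hi1 : Integrable (fun u => Real.fourierChar (inner ℝ (x - act Q u) ξ) • (g x * χ u))
      volume := by
    refine (χ.integrable.norm.const_mul ‖g x‖).mono' ?_ (Eventually.of_forall fun u => ?_)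
    · have := χ.continuous
      simp only [Circle.smul_def]
      exact Continuous.aestronglyMeasurable (by fun_prop)
    · rw [Circle.norm_smul, norm_mul]
  have hi2 : Integrable (fun u => Real.fourierChar (inner ℝ (x - act Q u) ξ) •
      (g (x - act Q u) * χ u)) volume := by
    refine (χ.integrable.norm.const_mul (SchwartzMap.seminorm ℂ 0 0 g)).mono' ?_
      (Eventually.of_forall fun u => ?_)
    · have := χ.continuous
      have := g.continuous
      simp only [Circle.smul_def]
      exact Continuous.aestronglyMeasurable (by fun_prop)
    · rw [Circle.norm_smul, norm_mul]
      gcongr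
      exact SchwartzMap.norm_le_seminorm ℂ g _
  have h3 : ‖(∫ u, Real.fourierChar (inner ℝ (x - act Q u) ξ) • (g x * χ u)) -
      waveConv g χ (act Q) ξ x‖ ≤ C * (∫ u, ‖u‖ * ‖χ u‖) * ‖act Q‖ := by
    rw [waveConv, ← integral_sub hi1 hi2]
    calc _ ≤ ∫ u, (C * ‖act Q‖) * (‖u‖ * ‖χ u‖) := by
          refine norm_integral_le_of_norm_le (hint.const_mul _) (Eventually.of_forall fun u => ?_)
          rw [← smul_sub, Circle.norm_smul, ← sub_mul, norm_mul]
          have h4 := hb x (x - act Q u)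
          rw [sub_sub_cancel] at h4
          have h5 := (act Q).le_opNorm u
          calc ‖g x - g (x - act Q u)‖ * ‖χ u‖ ≤ (C * (‖act Q‖ * ‖u‖)) * ‖χ u‖ := by
                gcongr; exact h4.trans (by gcongr)
            _ = _ := by ring
      _ = _ := by rw [integral_const_mul]; ring
  rw [h1] at h3
  have h6 := norm_sub_norm_le (Real.fourierChar (inner ℝ x ξ) •
    (g x * (𝓕 χ : 𝓢(Space d, ℂ)) (act Qᵀ ξ))) (waveConv g χ (act Q) ξ x)
  rw [Circle.norm_smul, norm_mul] at h6
  linarith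

theorem exists_bump_fourierInv (δ : ℝ) (hδ : 0 < δ) :
    ∃ b : 𝓢(Space d, ℂ), (∀ η, b η ≠ 0 → ‖η‖ ≤ δ) ∧ (𝓕⁻ b : 𝓢(Space d, ℂ)) 0 ≠ 0 := by
  let β : ContDiffBump (0 : Space d) := ⟨δ / 2, δ, by positivity, by linarith⟩
  have hc : HasCompactSupport fun x => (β x : ℂ) :=
    β.hasCompactSupport.comp_left Complex.ofReal_zero
  have hs : ContDiff ℝ ((⊤ : ℕ∞) : WithTop ℕ∞) fun x => (β x : ℂ) :=
    Complex.ofRealCLM.contDiff.comp β.contDiff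
  refine ⟨hc.toSchwartzMap hs, fun η hη => ?_, ?_⟩
  · have h1 : η ∈ Function.support β := fun h0 => hη (by
      change (β η : ℂ) = 0
      rw [h0, Complex.ofReal_zero])
    rw [β.support_eq, mem_ball_zero_iff] at h1
    exact h1.le
  · rw [SchwartzMap.fourierInv_coe, Real.fourierInv_eq]
    have h2 : ∫ v : Space d, Real.fourierChar (inner ℝ v (0 : Space d)) • (hc.toSchwartzMap hs) v =
        ((∫ v, β v : ℝ) : ℂ) := by
      rw [← integral_complex_ofReal]
      refine integral_congr_ae (Eventually.of_forall fun v => ?_)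
      simp only [inner_zero_right, AddChar.map_zero_eq_one, one_smul]
      rfl
    rw [h2]
    exact_mod_cast (β.integral_pos (μ := volume)).ne'

/-! ### Sequence norms, lacunary selection and integrability -/

theorem le_seqNorm {q : ℝ≥0∞} (hq : 0 < q) (c : ℕ → ℝ≥0∞) (k : ℕ) : c k ≤ seqNorm q c := by
  rw [seqNorm]
  split_ifs with h
  · exact le_iSup c k
  · have hq' : 0 < q.toReal := ENNReal.toReal_pos hq.ne' h
    calc c k = (c k ^ q.toReal) ^ (1 / q.toReal) := by
          rw [← ENNReal.rpow_mul, mul_one_div_cancel hq'.ne', ENNReal.rpow_one]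
      _ ≤ _ := ENNReal.rpow_le_rpow (ENNReal.le_tsum k) (by positivity)

theorem seqNorm_le_mul {q : ℝ≥0∞} (hq : 0 < q) {c v : ℕ → ℝ≥0∞} {D : ℝ≥0∞}
    (h : ∀ k, c k ≤ D * v k) : seqNorm q c ≤ D * seqNorm q v := by
  rw [seqNorm, seqNorm]
  split_ifs with hq'
  · rw [ENNReal.mul_iSup]
    exact iSup_mono h
  · have hq0 : 0 < q.toReal := ENNReal.toReal_pos hq.ne' hq'
    calc (∑' i, c i ^ q.toReal) ^ (1 / q.toReal)
        ≤ (∑' i, D ^ q.toReal * v i ^ q.toReal) ^ (1 / q.toReal) := by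
          refine ENNReal.rpow_le_rpow (ENNReal.tsum_le_tsum fun k => ?_) (by positivity)
          rw [← ENNReal.mul_rpow_of_nonneg _ _ hq0.le]
          exact ENNReal.rpow_le_rpow (h k) hq0.le
      _ = D * (∑' i, v i ^ q.toReal) ^ (1 / q.toReal) := by
          rw [ENNReal.tsum_mul_left, ENNReal.mul_rpow_of_nonneg _ _ (by positivity),
            ← ENNReal.rpow_mul, mul_one_div_cancel hq0.ne', ENNReal.rpow_one]

open Classical in
theorem seqNorm_lt_top_of_disjoint {q : ℝ≥0∞} (hq : 0 < q) (T : ℕ → Set ℕ)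
    (hT : ∀ m n k, k ∈ T m → k ∈ T n → m = n) (L : ℕ) (hL : ∀ n, (T n).encard ≤ L) :
    seqNorm q (fun k => ∑' n, if k ∈ T n then (2⁻¹ : ℝ≥0∞) ^ n else 0) < ∞ := by
  have h2 : (2⁻¹ : ℝ≥0∞) < 1 := by simp
  rw [seqNorm]
  split_ifs with hq'
  · refine lt_of_le_of_lt (iSup_le fun k => ENNReal.tsum_le_tsum (g := fun n => 2⁻¹ ^ n)
      fun n => ?_) ?_
    · split_ifs <;> simp
    · rw [ENNReal.tsum_geometric]
      simp
  · have hq0 : 0 < q.toReal := ENNReal.toReal_pos hq.ne' hq'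
    refine ENNReal.rpow_lt_top_of_nonneg (by positivity) (ne_of_lt ?_)
    -- Disjointness leaves at most one nonzero term, so the power passes inside the sum for every
    -- `q`, also below `1`.
    have h3 : ∀ k, (∑' n, if k ∈ T n then (2⁻¹ : ℝ≥0∞) ^ n else 0) ^ q.toReal ≤
        ∑' n, (T n).indicator (fun _ => ((2⁻¹ : ℝ≥0∞) ^ q.toReal) ^ n) k := by
      intro k
      by_cases hk : ∃ n, k ∈ T n
      · obtain ⟨n, hn⟩ := hk
        rw [tsum_eq_single n fun m hm => if_neg fun hmk => hm (hT m n k hmk hn), if_pos hn]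
        refine le_trans ?_ (ENNReal.le_tsum n)
        rw [Set.indicator_of_mem hn, ← ENNReal.rpow_natCast, ← ENNReal.rpow_natCast,
          ← ENNReal.rpow_mul, ← ENNReal.rpow_mul, mul_comm]
      · push Not at hk
        simp [hk, hq0]
    refine lt_of_le_of_lt (ENNReal.tsum_le_tsum h3) ?_
    rw [ENNReal.tsum_comm]
    have h4 : ∀ n, ∑' k, (T n).indicator (fun _ => ((2⁻¹ : ℝ≥0∞) ^ q.toReal) ^ n) k ≤
        L * ((2⁻¹ : ℝ≥0∞) ^ q.toReal) ^ n := fun n => by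
      rw [← tsum_subtype, ENNReal.tsum_set_const]
      gcongr
      exact_mod_cast hL n
    refine lt_of_le_of_lt (ENNReal.tsum_le_tsum h4) ?_
    rw [ENNReal.tsum_mul_left, ENNReal.tsum_geometric]
    refine ENNReal.mul_lt_top (by simp) (ENNReal.inv_lt_top.2 ?_)
    exact tsub_pos_of_lt (ENNReal.rpow_lt_one h2 hq0)

theorem exists_lacunary_seq {X : Type*} {l : Filter X} {S T : X → Set ℕ}
    (hSf : ∀ x, (S x).Finite) (hTf : ∀ x, (T x).Finite)
    (hS : ∀ k, ∀ᶠ x in l, k ∉ S x) (hT : ∀ k, ∀ᶠ x in l, k ∉ T x)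
    {a b : ℝ} (hb : 0 < b) {G : X → ℕ → ℕ → Prop}
    (h : ∀ K : ℝ, 0 < K → ∃ᶠ x in l, ∃ i j, G x i j ∧ K * b ^ j < a ^ i) :
    ∃ (x : ℕ → X) (i j : ℕ → ℕ), (∀ n, G (x n) (i n) (j n)) ∧
      (∀ n, 4 ^ n * b ^ (j n) ≤ a ^ (i n)) ∧
      (∀ m n k, k ∈ S (x m) → k ∈ S (x n) → m = n) ∧
      (∀ m n k, k ∈ T (x m) → k ∈ T (x n) → m = n) := by
  let ratio : X × ℕ × ℕ → ℝ := fun y => a ^ y.2.1 / b ^ y.2.2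
  obtain ⟨f, hf, hf'⟩ := exists_seq_of_forall_finset_exists
    (fun y : X × ℕ × ℕ => G y.1 y.2.1 y.2.2 ∧ 1 ≤ ratio y)
    (fun y z => 4 * ratio y ≤ ratio z ∧ (∀ k ∈ S y.1, k ∉ S z.1) ∧ ∀ k ∈ T y.1, k ∉ T z.1) (by
      intro s hs
      -- The sum dominates four times each earlier ratio; the summand `1` starts the induction
      -- behind `4 ^ n`.
      let K : ℝ := 1 + ∑ y ∈ s, 4 * ratio y
      have hnn : ∀ y ∈ s, 0 ≤ 4 * ratio y := fun y hy => by linarith [(hs y hy).2]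
      have hK : 1 ≤ K := by linarith [Finset.sum_nonneg hnn]
      have e1 : ∀ᶠ x in l, ∀ y ∈ s, ∀ k ∈ S y.1, k ∉ S x :=
        (Finset.eventually_all s).2 fun y _ => ((hSf y.1).eventually_all).2 fun k _ => hS k
      have e2 : ∀ᶠ x in l, ∀ y ∈ s, ∀ k ∈ T y.1, k ∉ T x :=
        (Finset.eventually_all s).2 fun y _ => ((hTf y.1).eventually_all).2 fun k _ => hT k
      obtain ⟨x, ⟨i, j, hG, hij⟩, h1, h2⟩ :=
        ((h K (by linarith)).and_eventually (e1.and e2)).exists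
      have hr : K < ratio (x, i, j) := (lt_div_iff₀ (by positivity)).2 hij
      refine ⟨(x, i, j), ⟨hG, by linarith⟩, fun y hy => ⟨?_, h1 y hy, h2 y hy⟩⟩
      have := Finset.single_le_sum hnn hy
      linarith)
  have hratio : ∀ n, 4 ^ n ≤ ratio (f n) := fun n => by
    induction n with
    | zero => simpa using (hf 0).2
    | succ n ih =>
      rw [pow_succ']
      linarith [(hf' n (n + 1) (Nat.lt_succ_self n)).1]
  refine ⟨fun n => (f n).1, fun n => (f n).2.1, fun n => (f n).2.2, fun n => (hf n).1, fun n => ?_,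
    fun m n k hm hn => ?_, fun m n k hm hn => ?_⟩
  · exact (le_div_iff₀ (by positivity)).1 (hratio n)
  · rcases lt_trichotomy m n with h1 | h1 | h1
    · exact absurd hn ((hf' m n h1).2.1 k hm)
    · exact h1
    · exact absurd hm ((hf' n m h1).2.1 k hn)
  · rcases lt_trichotomy m n with h1 | h1 | h1
    · exact absurd hn ((hf' m n h1).2.2 k hm)
    · exact h1
    · exact absurd hm ((hf' n m h1).2.2 k hn)

theorem lintegral_rpow_mul_one_add_norm_lt_top {C : ℝ} (hC : 0 ≤ C) {V : ℝ≥0∞} (hV : V ≠ ∞)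
    {p : ℝ} (hp : 0 < p) {m : ℕ} (hm : d < m * p) :
    ∫⁻ x : Space d, (ENNReal.ofReal (C * ((1 + ‖x‖) ^ m)⁻¹) * V) ^ p < ∞ := by
  have h1 : ∀ x : Space d, (ENNReal.ofReal (C * ((1 + ‖x‖) ^ m)⁻¹) * V) ^ p =
      (ENNReal.ofReal C * V) ^ p * ENNReal.ofReal ((1 + ‖x‖) ^ (-(m * p))) := fun x => by
    have hx : 0 ≤ 1 + ‖x‖ := by positivity
    rw [ENNReal.ofReal_mul hC, mul_right_comm, ENNReal.mul_rpow_of_nonneg _ _ hp.le,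
      ENNReal.ofReal_rpow_of_nonneg (by positivity) hp.le]
    congr 2
    rw [Real.rpow_neg hx, Real.rpow_mul hx, Real.rpow_natCast, Real.inv_rpow (by positivity)]
  simp_rw [h1]
  rw [lintegral_const_mul' _ _ (ENNReal.rpow_ne_top_of_nonneg hp.le
    (ENNReal.mul_ne_top ENNReal.ofReal_ne_top hV))]
  refine ENNReal.mul_lt_top (ENNReal.rpow_lt_top_of_nonneg hp.le
    (ENNReal.mul_ne_top ENNReal.ofReal_ne_top hV)) (finite_integral_one_add_norm ?_)
  simpa using hm

/-! ### Membership of wave sums in the Triebel–Lizorkin spaces -/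

theorem transpose_inv_pow (A : Matrix (Fin d) (Fin d) ℝ) (i : ℕ) :
    (A⁻¹ ^ i)ᵀ = Aᵀ⁻¹ ^ i := by
  rw [Matrix.transpose_pow, Matrix.transpose_nonsing_inv]

theorem waveConv_eq_zero_of_notMem_shell {A : GL (Fin d) ℝ} {φ Φ b : 𝓢(Space d, ℂ)}
    {r R δ : ℝ} (hloc : Localizes A φ Φ r R δ) (hb : ∀ η, b η ≠ 0 → ‖η‖ ≤ δ)
    {ξ : ℕ → Space d} (hξ : ∀ n, R < ‖ξ n‖) {i n : ℕ}
    (hi : i ∉ shell (A : Matrix (Fin d) (Fin d) ℝ)ᵀ⁻¹ r R (ξ n)) (x : Space d) :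
    waveConv (𝓕⁻ b) (profile φ Φ i) (act ((A : Matrix (Fin d) (Fin d) ℝ)⁻¹ ^ i)) (ξ n) x = 0 := by
  refine waveConv_eq_zero b _ _ _ _ δ hb fun η hη => ?_
  rw [transpose_inv_pow]
  exact hloc _ (hξ n) i hi η hη

theorem conv_window_eq_zero {A : GL (Fin d) ℝ} {φ Φ b : 𝓢(Space d, ℂ)}
    {r R δ : ℝ} (hloc : Localizes A φ Φ r R δ) (hb : ∀ η, b η ≠ 0 → ‖η‖ ≤ δ)
    {c : ℕ → ℂ} {ξ : ℕ → Space d}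
    {f : 𝓢'(Space d, ℂ)} (hf : ∀ u : 𝓢(Space d, ℂ), f u =
      ∑' n, c n * ∫ y, Real.fourierChar (inner ℝ y (ξ n)) • ((𝓕⁻ b : 𝓢(Space d, ℂ)) y * u y))
    (hξ : ∀ n, R < ‖ξ n‖) {i : ℕ}
    (hi : ∀ n, i ∉ shell (A : Matrix (Fin d) (Fin d) ℝ)ᵀ⁻¹ r R (ξ n)) (x : Space d) :
    conv f (window A φ Φ i) x = 0 := by
  rw [conv_window_of_tsum_wave A φ Φ (𝓕⁻ b) c ξ f hf]
  refine (tsum_congr fun n => ?_).trans tsum_zero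
  rw [waveConv_eq_zero_of_notMem_shell hloc hb hξ (hi n), mul_zero]

theorem conv_window_eq_single {A : GL (Fin d) ℝ} {φ Φ b : 𝓢(Space d, ℂ)}
    {r R δ : ℝ} (hloc : Localizes A φ Φ r R δ) (hb : ∀ η, b η ≠ 0 → ‖η‖ ≤ δ)
    {c : ℕ → ℂ} {ξ : ℕ → Space d}
    {f : 𝓢'(Space d, ℂ)} (hf : ∀ u : 𝓢(Space d, ℂ), f u =
      ∑' n, c n * ∫ y, Real.fourierChar (inner ℝ y (ξ n)) • ((𝓕⁻ b : 𝓢(Space d, ℂ)) y * u y))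
    (hξ : ∀ n, R < ‖ξ n‖)
    (hdisj : ∀ m n k, k ∈ shell (A : Matrix (Fin d) (Fin d) ℝ)ᵀ⁻¹ r R (ξ m) →
      k ∈ shell (A : Matrix (Fin d) (Fin d) ℝ)ᵀ⁻¹ r R (ξ n) → m = n) {i n : ℕ}
    (hi : i ∈ shell (A : Matrix (Fin d) (Fin d) ℝ)ᵀ⁻¹ r R (ξ n)) (x : Space d) :
    conv f (window A φ Φ i) x = c n *
      waveConv (𝓕⁻ b) (profile φ Φ i) (act ((A : Matrix (Fin d) (Fin d) ℝ)⁻¹ ^ i)) (ξ n) x := by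
  rw [conv_window_of_tsum_wave A φ Φ (𝓕⁻ b) c ξ f hf, tsum_eq_single n]
  intro m hm
  rw [waveConv_eq_zero_of_notMem_shell hloc hb hξ (fun h => hm (hdisj m n i h hi)), mul_zero]

theorem mem_TLSpace_iff {A : GL (Fin d) ℝ} {φ Φ : 𝓢(Space d, ℂ)} {α : ℝ} {p q : ℝ≥0∞}
    (hp : 0 < p) (hp' : p < ∞) {f : 𝓢'(Space d, ℂ)} :
    f ∈ TLSpace A φ Φ α p q ↔ ∫⁻ x : Space d, (seqNorm q fun i : ℕ =>
      ENNReal.ofReal ((|(A : Matrix (Fin d) (Fin d) ℝ).det| ^ α) ^ i) *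
        ‖conv f (window A φ Φ i) x‖ₑ) ^ p.toReal < ∞ := by
  rw [TLSpace, Set.mem_ofPred_eq, tlNorm,
    eLpNorm_lt_top_iff_lintegral_rpow_enorm_lt_top hp.ne' hp'.ne]
  simp only [enorm_eq_self, Real.rpow_mul_natCast (abs_nonneg _)]

/-- Each window sees at most one wave, so the weighted pieces are dominated by a fixed decaying
function of `x` times a sequence of finite `ℓ^q` norm. -/
theorem mem_TLSpace_of_wave_sum {B : GL (Fin d) ℝ} {ψ Ψ b : 𝓢(Space d, ℂ)}
    {r R δ : ℝ} (hloc : Localizes B ψ Ψ r R δ) (hb : ∀ η, b η ≠ 0 → ‖η‖ ≤ δ)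
    {c : ℕ → ℂ} {ξ : ℕ → Space d}
    {f : 𝓢'(Space d, ℂ)} (hf : ∀ u : 𝓢(Space d, ℂ), f u =
      ∑' n, c n * ∫ y, Real.fourierChar (inner ℝ y (ξ n)) • ((𝓕⁻ b : 𝓢(Space d, ℂ)) y * u y))
    (hξ : ∀ n, R < ‖ξ n‖)
    (hdisj : ∀ m n k, k ∈ shell (B : Matrix (Fin d) (Fin d) ℝ)ᵀ⁻¹ r R (ξ m) →
      k ∈ shell (B : Matrix (Fin d) (Fin d) ℝ)ᵀ⁻¹ r R (ξ n) → m = n)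
    (hr : 0 < r) (hN : PowDecay (B : Matrix (Fin d) (Fin d) ℝ)⁻¹)
    (hN' : PowDecay (B : Matrix (Fin d) (Fin d) ℝ)ᵀ⁻¹) {α : ℝ} {p q : ℝ≥0∞}
    (hp : 0 < p) (hp' : p < ∞) (hq : 0 < q) {K : ℝ} (hK : 0 ≤ K)
    (hc : ∀ n, ∀ k ∈ shell (B : Matrix (Fin d) (Fin d) ℝ)ᵀ⁻¹ r R (ξ n),
      (|(B : Matrix (Fin d) (Fin d) ℝ).det| ^ α) ^ k * ‖c n‖ ≤ K * 2⁻¹ ^ n) :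
    f ∈ TLSpace B ψ Ψ α p q := by
  classical
  set T : ℕ → Set ℕ := fun n => shell (B : Matrix (Fin d) (Fin d) ℝ)ᵀ⁻¹ r R (ξ n) with hTdef
  have hp0 : 0 < p.toReal := ENNReal.toReal_pos hp.ne' hp'.ne
  obtain ⟨m, hm⟩ : ∃ m : ℕ, d < m * p.toReal := by
    obtain ⟨m, hm⟩ := exists_nat_gt (d / p.toReal)
    exact ⟨m, (div_lt_iff₀ hp0).1 hm⟩
  obtain ⟨D, hD, hDb⟩ := hN.exists_bound
  have hCex : ∀ χ : 𝓢(Space d, ℂ), ∃ C : ℝ, 0 ≤ C ∧ ∀ i ξ x,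
      ‖waveConv (𝓕⁻ b) χ (act ((B : Matrix (Fin d) (Fin d) ℝ)⁻¹ ^ i)) ξ x‖ ≤
        C * ((1 + ‖x‖) ^ m)⁻¹ := fun χ => by
    obtain ⟨C, hC, h⟩ := exists_norm_waveConv_le (𝓕⁻ b) χ m hD
    exact ⟨C, hC, fun i => h _ (hDb i)⟩
  obtain ⟨C₁, hC₁, h₁⟩ := hCex ψ
  obtain ⟨C₂, hC₂, h₂⟩ := hCex Ψ
  have hwave : ∀ i ξ x, ‖waveConv (𝓕⁻ b) (profile ψ Ψ i)
      (act ((B : Matrix (Fin d) (Fin d) ℝ)⁻¹ ^ i)) ξ x‖ ≤ (C₁ + C₂) * ((1 + ‖x‖) ^ m)⁻¹ := by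
    intro i ξ x
    have h0 : 0 ≤ ((1 + ‖x‖) ^ m)⁻¹ := by positivity
    rw [profile]
    split_ifs
    · exact (h₂ i ξ x).trans (by gcongr; linarith)
    · exact (h₁ i ξ x).trans (by gcongr; linarith)
  obtain ⟨L, hL⟩ := exists_shell_diam (R := R) hN' hr
  have hcard : ∀ n, (T n).encard ≤ ((2 * L + 1 : ℕ) : ℕ∞) := by
    intro n
    rcases (T n).eq_empty_or_nonempty with h0 | ⟨k, hk⟩
    · simp [h0]
    · have hsub : T n ⊆ (Finset.Icc (k - L) (k + L) : Finset ℕ) := fun j hj => by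
        have h1 := hL _ k hk j hj
        have h2 := hL _ j hj k hk
        simp only [Finset.coe_Icc, Set.mem_Icc]
        omega
      refine (Set.encard_le_encard hsub).trans ?_
      rw [Set.encard_coe_eq_coe_finsetCard, Nat.card_Icc]
      exact_mod_cast (by omega : k + L + 1 - (k - L) ≤ 2 * L + 1)
  have hV := seqNorm_lt_top_of_disjoint hq T hdisj _ hcard
  set v : ℕ → ℝ≥0∞ := fun k => ∑' n, if k ∈ T n then (2⁻¹ : ℝ≥0∞) ^ n else 0 with hv
  rw [mem_TLSpace_iff hp hp']
  refine lt_of_le_of_lt (lintegral_mono fun x => ?_)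
    (lintegral_rpow_mul_one_add_norm_lt_top (C := K * (C₁ + C₂)) (by positivity) hV.ne hp0 hm)
  refine ENNReal.rpow_le_rpow (seqNorm_le_mul hq fun k => ?_) hp0.le
  by_cases hk : ∃ n, k ∈ T n
  · obtain ⟨n, hn⟩ := hk
    have hvk : (2⁻¹ : ℝ≥0∞) ^ n ≤ v k := by
      refine le_trans ?_ (ENNReal.le_tsum n)
      rw [if_pos hn]
    have h2 : ENNReal.ofReal (2⁻¹ ^ n) = (2⁻¹ : ℝ≥0∞) ^ n := by
      rw [ENNReal.ofReal_pow (by norm_num), ENNReal.ofReal_inv_of_pos (by norm_num)]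
      simp
    rw [conv_window_eq_single hloc hb hf hξ hdisj hn, ← ofReal_norm,
      ← ENNReal.ofReal_mul (by positivity)]
    refine le_trans ?_ (mul_le_mul_right hvk _)
    rw [← h2, ← ENNReal.ofReal_mul (by positivity), norm_mul]
    refine ENNReal.ofReal_le_ofReal ?_
    calc _ = ((|(B : Matrix (Fin d) (Fin d) ℝ).det| ^ α) ^ k * ‖c n‖) *
          ‖waveConv (𝓕⁻ b) (profile ψ Ψ k)
            (act ((B : Matrix (Fin d) (Fin d) ℝ)⁻¹ ^ k)) (ξ n) x‖ := by ring
      _ ≤ (K * 2⁻¹ ^ n) * ((C₁ + C₂) * ((1 + ‖x‖) ^ m)⁻¹) := by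
          exact mul_le_mul (hc n k hn) (hwave _ _ _) (norm_nonneg _) (by positivity)
      _ = _ := by ring
  · push Not at hk
    rw [conv_window_eq_zero hloc hb hf hξ hk]
    simp

/-- The single piece of index `i n` already bounds the sequence norm below by `κ * 2 ^ n`, making it
infinite on a whole ball. -/
theorem notMem_TLSpace_of_wave_sum {A : GL (Fin d) ℝ} {φ Φ b : 𝓢(Space d, ℂ)}
    {r R δ : ℝ} (hloc : Localizes A φ Φ r R δ) (hb : ∀ η, b η ≠ 0 → ‖η‖ ≤ δ)
    {c : ℕ → ℂ} {ξ : ℕ → Space d}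
    {f : 𝓢'(Space d, ℂ)} (hf : ∀ u : 𝓢(Space d, ℂ), f u =
      ∑' n, c n * ∫ y, Real.fourierChar (inner ℝ y (ξ n)) • ((𝓕⁻ b : 𝓢(Space d, ℂ)) y * u y))
    (hξ : ∀ n, R < ‖ξ n‖)
    (hdisj : ∀ m n k, k ∈ shell (A : Matrix (Fin d) (Fin d) ℝ)ᵀ⁻¹ r R (ξ m) →
      k ∈ shell (A : Matrix (Fin d) (Fin d) ℝ)ᵀ⁻¹ r R (ξ n) → m = n)
    {α : ℝ} {p q : ℝ≥0∞} (hp : 0 < p) (hp' : p < ∞) (hq : 0 < q) {s κ : ℝ} (hs : 0 < s)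
    (hκ : 0 < κ) {i : ℕ → ℕ}
    (hi : ∀ n, i n ∈ shell (A : Matrix (Fin d) (Fin d) ℝ)ᵀ⁻¹ r R (ξ n))
    (hc : ∀ n x, ‖x‖ < s → κ * 2 ^ n ≤
      (|(A : Matrix (Fin d) (Fin d) ℝ).det| ^ α) ^ (i n) * (‖c n‖ *
        ‖waveConv (𝓕⁻ b) (profile φ Φ (i n))
          (act ((A : Matrix (Fin d) (Fin d) ℝ)⁻¹ ^ (i n))) (ξ n) x‖)) :
    f ∉ TLSpace A φ Φ α p q := by
  have hp0 : 0 < p.toReal := ENNReal.toReal_pos hp.ne' hp'.ne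
  rw [mem_TLSpace_iff hp hp', not_lt, top_le_iff]
  refine top_le_iff.1 (le_trans ?_ (setLIntegral_le_lintegral (Metric.ball 0 s) _))
  refine le_trans ?_ (setLIntegral_mono' (f := fun _ => ∞) measurableSet_ball fun x hx => ?_)
  · rw [setLIntegral_const, ENNReal.top_mul (Metric.measure_ball_pos volume 0 hs).ne']
  · suffices h : (seqNorm q fun i : ℕ =>
        ENNReal.ofReal ((|(A : Matrix (Fin d) (Fin d) ℝ).det| ^ α) ^ i) *
          ‖conv f (window A φ Φ i) x‖ₑ) = ∞ by
      rw [h, ENNReal.top_rpow_of_pos hp0]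
    refine ENNReal.eq_top_of_forall_nnreal_le fun t => ?_
    obtain ⟨n, hn⟩ : ∃ n : ℕ, (t : ℝ) < κ * 2 ^ n := by
      obtain ⟨n, hn⟩ := pow_unbounded_of_one_lt (t / κ : ℝ) (one_lt_two)
      exact ⟨n, (div_lt_iff₀' hκ).1 hn⟩
    refine le_trans ?_ (le_seqNorm hq _ (i n))
    rw [conv_window_eq_single hloc hb hf hξ hdisj (hi n), ← ofReal_norm,
      ← ENNReal.ofReal_mul (by positivity), norm_mul, ← ENNReal.ofReal_coe_nnreal]
    exact ENNReal.ofReal_le_ofReal (hn.le.trans (hc n x (by simpa using hx)))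

theorem Localizes.mem_shell {A : GL (Fin d) ℝ} {φ Φ : 𝓢(Space d, ℂ)} {r R δ c : ℝ}
    (h : Localizes A φ Φ r R δ) (hδ : 0 ≤ δ) (hc : 0 < c) {ξ : Space d} {i : ℕ} (hξ : R < ‖ξ‖)
    (hi : 1 ≤ i)
    (hci : c ≤ ‖(𝓕 φ : 𝓢(Space d, ℂ)) (act ((A : Matrix (Fin d) (Fin d) ℝ)ᵀ⁻¹ ^ i) ξ)‖) :
    i ∈ shell (A : Matrix (Fin d) (Fin d) ℝ)ᵀ⁻¹ r R ξ := by
  by_contra hn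
  have h1 := h ξ hξ i hn 0 (by simpa using hδ)
  rw [profile, if_neg (by omega), zero_add] at h1
  rw [h1, norm_zero] at hci
  linarith

/-! ### From inclusion of spaces to coarse equivalence -/

/-- By contradiction: failure for every `K` supplies the lacunary frequencies of a distribution in
the `B`-space but not in the `A`-space. No closed graph argument is needed. -/
theorem exists_eventually_pow_le_of_TLSpace_subset [NeZero d] {A B : GL (Fin d) ℝ}
    {φ Φ ψ Ψ : 𝓢(Space d, ℂ)} {rA RA δA rB RB δB : ℝ}
    (hlocA : Localizes A φ Φ rA RA δA) (hlocB : Localizes B ψ Ψ rB RB δB)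
    (hrA : 0 < rA) (hrB : 0 < rB) (hδA : 0 < δA) (hδB : 0 < δB)
    (hNA : PowDecay (A : Matrix (Fin d) (Fin d) ℝ)⁻¹)
    (hNA' : PowDecay (A : Matrix (Fin d) (Fin d) ℝ)ᵀ⁻¹)
    (hNB : PowDecay (B : Matrix (Fin d) (Fin d) ℝ)⁻¹)
    (hNB' : PowDecay (B : Matrix (Fin d) (Fin d) ℝ)ᵀ⁻¹)
    {α : ℝ} {p q : ℝ≥0∞} (hp : 0 < p) (hp' : p < ∞) (hq : 0 < q)
    (hsub : TLSpace B ψ Ψ α p q ⊆ TLSpace A φ Φ α p q) {cA : ℝ} (hcA : 0 < cA) :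
    ∃ K : ℝ, 0 < K ∧ ∀ᶠ ξ in cobounded (Space d), ∀ i : ℕ, 1 ≤ i →
      cA ≤ ‖(𝓕 φ : 𝓢(Space d, ℂ)) (act ((A : Matrix (Fin d) (Fin d) ℝ)ᵀ⁻¹ ^ i) ξ)‖ →
      ∀ j ∈ shell (B : Matrix (Fin d) (Fin d) ℝ)ᵀ⁻¹ rB RB ξ,
        (|(A : Matrix (Fin d) (Fin d) ℝ).det| ^ α) ^ i ≤
          K * (|(B : Matrix (Fin d) (Fin d) ℝ).det| ^ α) ^ j := by
  have hunit : ∀ M : GL (Fin d) ℝ, IsUnit (M : Matrix (Fin d) (Fin d) ℝ)ᵀ⁻¹ := fun M =>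
    Matrix.isUnit_nonsing_inv_iff.2 ((Matrix.isUnit_transpose _).2 M.isUnit)
  have hdet : ∀ M : GL (Fin d) ℝ, 0 < |(M : Matrix (Fin d) (Fin d) ℝ).det| := fun M =>
    abs_pos.2 ((Matrix.isUnit_iff_isUnit_det _).1 M.isUnit).ne_zero
  set NA := (A : Matrix (Fin d) (Fin d) ℝ)ᵀ⁻¹ with hNAdef
  set NB := (B : Matrix (Fin d) (Fin d) ℝ)ᵀ⁻¹ with hNBdef
  set a := |(A : Matrix (Fin d) (Fin d) ℝ).det| ^ α with ha_def
  set b := |(B : Matrix (Fin d) (Fin d) ℝ).det| ^ α with hb_def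
  have ha : 0 < a := Real.rpow_pos_of_pos (hdet A) α
  have hb : 0 < b := Real.rpow_pos_of_pos (hdet B) α
  by_contra! hcon
  obtain ⟨β, hβ, hg0⟩ := exists_bump_fourierInv (d := d) (min δA δB) (lt_min hδA hδB)
  have hβA : ∀ η, β η ≠ 0 → ‖η‖ ≤ δA := fun η h => (hβ η h).trans (min_le_left _ _)
  have hβB : ∀ η, β η ≠ 0 → ‖η‖ ≤ δB := fun η h => (hβ η h).trans (min_le_right _ _)
  set γ := ‖(𝓕⁻ β : 𝓢(Space d, ℂ)) 0‖ / 2 with hγ_def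
  have hγ : 0 < γ := half_pos (norm_pos_iff.2 hg0)
  obtain ⟨s, hs, hsb⟩ : ∃ s : ℝ, 0 < s ∧ ∀ x, ‖x‖ < s → γ ≤ ‖(𝓕⁻ β : 𝓢(Space d, ℂ)) x‖ := by
    have h1 := (𝓕⁻ β : 𝓢(Space d, ℂ)).continuous.norm.continuousAt.eventually_const_lt
      (half_lt_self (norm_pos_iff.2 hg0))
    obtain ⟨s, hs, h2⟩ := Metric.eventually_nhds_iff.1 h1
    exact ⟨s, hs, fun x hx => (h2 (by simpa using hx)).le⟩
  obtain ⟨C, hC, hlow⟩ := exists_le_norm_waveConv (𝓕⁻ β) φ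
  -- Large frequencies have only large shell indices, so the error term of `hlow` is at most half of
  -- the main term `γ * cA`.
  have hsmall : ∀ᶠ i : ℕ in atTop,
      C * ‖act ((A : Matrix (Fin d) (Fin d) ℝ)⁻¹ ^ i)‖ < γ * cA / 2 := by
    have := hNA.tendsto.const_mul C
    rw [mul_zero] at this
    exact this.eventually_lt_const (by positivity)
  let G : Space d → ℕ → ℕ → Prop := fun ξ i j => RA < ‖ξ‖ ∧ RB < ‖ξ‖ ∧ 1 ≤ i ∧
    cA ≤ ‖(𝓕 φ : 𝓢(Space d, ℂ)) (act (NA ^ i) ξ)‖ ∧ j ∈ shell NB rB RB ξ ∧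
    C * ‖act ((A : Matrix (Fin d) (Fin d) ℝ)⁻¹ ^ i)‖ < γ * cA / 2
  have hfreq : ∀ K : ℝ, 0 < K → ∃ᶠ ξ in cobounded (Space d), ∃ i j, G ξ i j ∧
      K * b ^ j < a ^ i := by
    intro K hK
    refine ((hcon K hK).and_eventually (((tendsto_norm_cobounded_atTop.eventually_gt_atTop RA).and
      (tendsto_norm_cobounded_atTop.eventually_gt_atTop RB)).and
      (eventually_forall_shell (hunit A) rA RA hsmall))).mono ?_
    rintro ξ ⟨⟨i, hi, hci, j, hj, hij⟩, ⟨h1, h2⟩, h3⟩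
    exact ⟨i, j, ⟨h1, h2, hi, hci, hj, h3 i (hlocA.mem_shell hδA.le hcA h1 hi hci)⟩, hij⟩
  obtain ⟨ξ, i, j, hG, hratio, hdisjA, hdisjB⟩ := exists_lacunary_seq
    (shell_finite hNA' hrA RA) (shell_finite hNB' hrB RB)
    (eventually_notMem_shell (hunit A) rA RA) (eventually_notMem_shell (hunit B) rB RB) hb hfreq
  obtain ⟨K₁, k, hK₁, hgrow⟩ := exists_pow_le_norm_pow_of_shell (R := RB) hNB' hrB
    (inv_pos.2 hb).le
  obtain ⟨K₂, hK₂, hcomp⟩ := exists_pow_le_of_shell (R := RB) hNB' hrB hb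
  -- `b⁻¹ ^ j n` normalizes the `n`-th wave in the `B`-space. The factor `2⁻¹ ^ n` gives summability
  -- there and still leaves `4 ^ n * 2⁻¹ ^ n = 2 ^ n` in the `A`-space.
  let c : ℕ → ℂ := fun n => ((2⁻¹ ^ n * b⁻¹ ^ (j n) : ℝ) : ℂ)
  have hc : ∀ n, ‖c n‖ = 2⁻¹ ^ n * b⁻¹ ^ (j n) := fun n => by
    rw [Complex.norm_real, Real.norm_of_nonneg (by positivity)]
  have hsum : Summable fun n : ℕ => K₁ * (2⁻¹ : ℝ) ^ n :=
    (summable_geometric_of_lt_one (by norm_num) (by norm_num)).mul_left _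
  obtain ⟨f, hf⟩ := exists_temperedDistribution_tsum_wave (𝓕⁻ β) c ξ _ k hsum fun n => by
    rw [hc]
    calc (2⁻¹ : ℝ) ^ n * b⁻¹ ^ (j n) ≤ 2⁻¹ ^ n * (K₁ * ‖ξ n‖ ^ k) := by
          gcongr
          exact hgrow _ _ (hG n).2.2.2.2.1
      _ = _ := by ring
  refine notMem_TLSpace_of_wave_sum hlocA hβA hf (fun n => (hG n).1) hdisjA hp hp' hq hs
    (κ := γ * cA / 2) (by positivity) (i := i)
    (fun n => hlocA.mem_shell hδA.le hcA (hG n).1 (hG n).2.2.1 (hG n).2.2.2.1) (fun n x hx => ?_)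
    (hsub (mem_TLSpace_of_wave_sum hlocB hβB hf (fun n => (hG n).2.1) hdisjB hrB hNB hNB'
      hp hp' hq (K := K₂) (by positivity) fun n l hl => ?_))
  · obtain ⟨-, -, hi1, hci, -, hsm⟩ := hG n
    have h1 := hlow ((A : Matrix (Fin d) (Fin d) ℝ)⁻¹ ^ i n) (ξ n) x
    rw [transpose_inv_pow] at h1
    rw [profile, if_neg (by omega), hc]
    have h2 : γ * cA ≤ ‖(𝓕⁻ β : 𝓢(Space d, ℂ)) x‖ *
        ‖(𝓕 φ : 𝓢(Space d, ℂ)) (act (NA ^ i n) (ξ n))‖ := by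
      gcongr
      exact hsb x hx
    have h3 : γ * cA / 2 ≤ ‖waveConv (𝓕⁻ β) φ
        (act ((A : Matrix (Fin d) (Fin d) ℝ)⁻¹ ^ i n)) (ξ n) x‖ := by linarith
    have h4 : (2 : ℝ) ^ n ≤ a ^ i n * (2⁻¹ ^ n * b⁻¹ ^ j n) := by
      calc (2 : ℝ) ^ n = (4 ^ n * b ^ j n) * (2⁻¹ ^ n * b⁻¹ ^ j n) := by
            rw [show (4 : ℝ) = 2 * 2 by norm_num, mul_pow, inv_pow, inv_pow]
            field_simp
        _ ≤ _ := by gcongr; exact hratio n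
    calc γ * cA / 2 * 2 ^ n ≤ _ := mul_le_mul h3 h4 (by positivity) (norm_nonneg _)
      _ = _ := by ring
  · rw [hc]
    calc b ^ l * (2⁻¹ ^ n * b⁻¹ ^ j n) ≤ (K₂ * b ^ j n) * (2⁻¹ ^ n * b⁻¹ ^ j n) := by
          gcongr
          exact hcomp _ _ (hG n).2.2.2.2.1 _ hl
      _ = _ := by rw [inv_pow b]; field_simp

theorem pow_le_of_rpow_pow_le {α : ℝ} (hα : 0 < α) {x y K : ℝ} (hx : 0 ≤ x) (hy : 0 ≤ y)
    (hK : 0 ≤ K) {i j : ℕ} (h : (x ^ α) ^ i ≤ K * (y ^ α) ^ j) : x ^ i ≤ K ^ α⁻¹ * y ^ j := by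
  rw [← Real.rpow_mul_natCast hx, ← Real.rpow_mul_natCast hy, mul_comm α, mul_comm α,
    Real.rpow_natCast_mul hx, Real.rpow_natCast_mul hy] at h
  have h1 := Real.rpow_le_rpow (by positivity) h (inv_pos.2 hα).le
  rwa [Real.mul_rpow hK (by positivity), Real.rpow_rpow_inv (by positivity) hα.ne',
    Real.rpow_rpow_inv (by positivity) hα.ne'] at h1

/-- For negative `α` taking roots reverses the inequality, so the two inclusions exchange roles. -/
theorem pow_le_of_rpow_neg_pow_le {α : ℝ} (hα : α < 0) {x y K : ℝ} (hx : 0 < x) (hy : 0 < y)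
    (hK : 0 ≤ K) {i j : ℕ} (h : (x ^ α) ^ i ≤ K * (y ^ α) ^ j) :
    y ^ j ≤ K ^ (-α)⁻¹ * x ^ i := by
  refine pow_le_of_rpow_pow_le (neg_pos.2 hα) hy.le hx.le hK ?_
  rw [Real.rpow_neg hx.le, Real.rpow_neg hy.le, inv_pow, inv_pow]
  have hx' : 0 < (x ^ α) ^ i := pow_pos (Real.rpow_pos_of_pos hx α) i
  have hy' : 0 < (y ^ α) ^ j := pow_pos (Real.rpow_pos_of_pos hy α) j
  rw [inv_le_iff_one_le_mul₀ hy', mul_right_comm, ← div_eq_mul_inv, le_div_iff₀ hx', one_mul]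
  exact h

theorem coarselyEquivalent_transpose_of_TLSpace_eq {A B : GL (Fin d) ℝ}
    (hA : IsExpansive (A : Matrix (Fin d) (Fin d) ℝ))
    (hB : IsExpansive (B : Matrix (Fin d) (Fin d) ℝ)) {φ Φ ψ Ψ : 𝓢(Space d, ℂ)}
    (hφ : IsAnalyzingPair A φ Φ) (hψ : IsAnalyzingPair B ψ Ψ) {α : ℝ} (hα : α ≠ 0)
    {p q : ℝ≥0∞} (hp : 0 < p) (hp' : p < ∞) (hq : 0 < q)
    (hF : TLSpace A φ Φ α p q = TLSpace B ψ Ψ α p q) :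
    CoarselyEquivalent (A : Matrix (Fin d) (Fin d) ℝ)ᵀ (B : Matrix (Fin d) (Fin d) ℝ)ᵀ := by
  -- In dimension `0` the determinant is `1` and `|N.det| < 1` fails, but the space is a point and
  -- both quasi-norms vanish.
  rcases eq_or_ne d 0 with rfl | hd
  · intro ρ ρ' hρ hρ'
    refine ⟨1, 0, one_pos, le_rfl, fun x => ?_⟩
    rw [(hρ.eq_zero_iff x).2 (Subsingleton.elim _ _), (hρ'.eq_zero_iff x).2 (Subsingleton.elim _ _)]
    norm_num
  have : NeZero d := ⟨hd⟩
  have hAt : IsUnit (A : Matrix (Fin d) (Fin d) ℝ)ᵀ := (Matrix.isUnit_transpose _).2 A.isUnit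
  have hBt : IsUnit (B : Matrix (Fin d) (Fin d) ℝ)ᵀ := (Matrix.isUnit_transpose _).2 B.isUnit
  have hNA : PowDecay (A : Matrix (Fin d) (Fin d) ℝ)⁻¹ := hA.powDecay_inv A.isUnit
  have hNB : PowDecay (B : Matrix (Fin d) (Fin d) ℝ)⁻¹ := hB.powDecay_inv B.isUnit
  have hNA' : PowDecay (A : Matrix (Fin d) (Fin d) ℝ)ᵀ⁻¹ :=
    hA.transpose.powDecay_inv hAt
  have hNB' : PowDecay (B : Matrix (Fin d) (Fin d) ℝ)ᵀ⁻¹ :=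
    hB.transpose.powDecay_inv hBt
  obtain ⟨rA, RA, δA, hrA, hδA, hlocA⟩ := hφ.exists_localizes hNA'
  obtain ⟨rB, RB, δB, hrB, hδB, hlocB⟩ := hψ.exists_localizes hNB'
  obtain ⟨cA, hcA, hgoodA⟩ := hφ.exists_le_norm_fourier hNA'
  obtain ⟨cB, hcB, hgoodB⟩ := hψ.exists_le_norm_fourier hNB'
  obtain ⟨K, hK, hAB⟩ := exists_eventually_pow_le_of_TLSpace_subset hlocA hlocB hrA hrB hδA hδB
    hNA hNA' hNB hNB' hp hp' hq hF.ge hcA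
  obtain ⟨K', hK', hBA⟩ := exists_eventually_pow_le_of_TLSpace_subset hlocB hlocA hrB hrA hδB hδA
    hNB hNB' hNA hNA' hp hp' hq hF.le hcB
  have hdetA : 0 < |(A : Matrix (Fin d) (Fin d) ℝ).det| :=
    abs_pos.2 ((Matrix.isUnit_iff_isUnit_det _).1 A.isUnit).ne_zero
  have hdetB : 0 < |(B : Matrix (Fin d) (Fin d) ℝ).det| :=
    abs_pos.2 ((Matrix.isUnit_iff_isUnit_det _).1 B.isUnit).ne_zero
  -- One constant for both signs of `α`.
  set L := max (max (K ^ α⁻¹) (K' ^ α⁻¹)) (max (K ^ (-α)⁻¹) (K' ^ (-α)⁻¹)) with hL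
  refine coarselyEquivalent_of_shell hAt hBt hNA' hNB' (r := rA) (R := RA) (r' := rB) (R' := RB)
    (K := L) hrA hrB
    (lt_max_of_lt_left (lt_max_of_lt_left (Real.rpow_pos_of_pos hK _))) ?_
  filter_upwards [hgoodA, hgoodB, hAB, hBA,
    tendsto_norm_cobounded_atTop.eventually_gt_atTop RA,
    tendsto_norm_cobounded_atTop.eventually_gt_atTop RB] with ξ h1 h2 h3 h4 h5 h6
  obtain ⟨i, hi, hci⟩ := h1
  obtain ⟨j, hj, hcj⟩ := h2
  have hiA := hlocA.mem_shell hδA.le hcA h5 hi hci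
  have hjB := hlocB.mem_shell hδB.le hcB h6 hj hcj
  have h7 := h3 i hi hci j hjB
  have h8 := h4 j hj hcj i hiA
  refine ⟨i, hiA, j, hjB, ?_⟩
  rw [Matrix.det_transpose, Matrix.det_transpose]
  rcases lt_or_gt_of_ne hα with hα | hα
  · have h9 := pow_le_of_rpow_neg_pow_le hα hdetA hdetB hK.le h7
    have h10 := pow_le_of_rpow_neg_pow_le hα hdetB hdetA hK'.le h8
    exact ⟨h10.trans (by gcongr; exact (le_max_right _ _).trans (le_max_right _ _)),
      h9.trans (by gcongr; exact (le_max_left _ _).trans (le_max_right _ _))⟩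
  · have h9 := pow_le_of_rpow_pow_le hα hdetA.le hdetB.le hK.le h7
    have h10 := pow_le_of_rpow_pow_le hα hdetB.le hdetA.le hK'.le h8
    exact ⟨h9.trans (by gcongr; exact (le_max_left _ _).trans (le_max_left _ _)),
      h10.trans (by gcongr; exact (le_max_right _ _).trans (le_max_left _ _))⟩

end AnisotropicTL

end

theorem theorem5p5 (d : ℕ) (A B : GL (Fin d) ℝ)
    (hA : AnisotropicTL.IsExpansive (A : Matrix (Fin d) (Fin d) ℝ))
    (hB : AnisotropicTL.IsExpansive (B : Matrix (Fin d) (Fin d) ℝ))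
    (φ Φ ψ Ψ : 𝓢(AnisotropicTL.Space d, ℂ))
    (hφ : AnisotropicTL.IsAnalyzingPair A φ Φ)
    (hψ : AnisotropicTL.IsAnalyzingPair B ψ Ψ)
    (α : ℝ) (hα : α ≠ 0)
    (p q : ℝ≥0∞) (hp : 0 < p) (hp' : p < ∞) (hq : 0 < q)
    (hF : AnisotropicTL.TLSpace A φ Φ α p q = AnisotropicTL.TLSpace B ψ Ψ α p q) :
    AnisotropicTL.CoarselyEquivalent
      (A : Matrix (Fin d) (Fin d) ℝ)ᵀ (B : Matrix (Fin d) (Fin d) ℝ)ᵀ :=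
  AnisotropicTL.coarselyEquivalent_transpose_of_TLSpace_eq hA hB hφ hψ hα hp hp' hq hF
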